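/- Let $k$ be a field and let $\Gamma$ be a finite quiver with a linear order on its set of vertices such that every arrow goes from a smaller to a larger vertex. Assume that $\Gamma$ is connected (as an unoriented graph) and nontrivial (it has more than one vertex), and let $l$ be the maximal length of a path in $\Gamma$. Let $R\subset k\Gamma$ be the ideal of the path algebra spanned by the paths of positive length, let $I\subset R^2$ be a two-sided ideal of $k\Gamma$, and let $A=k\Gamma/I$ be the corresponding path algebra with relations. Let $\operatorname{Perf}A$ be the full subcategory of the derived category $D(A)$ of right $A$-modules formed by the objects isomorphic to bounded complexes of finitely generated projective modules. A Serre functor on $\operatorname{Perf}A$ is a functor $S$ from $\operatorname{Perf}A$ to itself with $k$-linear isomorphisms $\operatorname{Hom}(X,Y)\cong\operatorname{Hom}(Y,S(X))^*$, functorial in $X$ and $Y$. An object $G$ is a classical generator of $\operatorname{Perf} A$ if every object of $\operatorname{Perf}A$ is obtained from $G$ by finitely many shifts, finite direct sums, extensions and direct summands. Then: 1. $\operatorname{Perf}A$ has a Serre functor and a classical generator, and for every Serre functor $S$ and every classical generator $G$ the lower Serre dimension $$\operatorname{LSdim}(A)=\liminf_{m\to+\infty}\frac{-\sup\{i\in\mathbb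 Z\mid \operatorname{Hom}(G,S^m(G)[i])\neq 0\}}{m}$$ satisfies $\operatorname{LSdim}(A)\ge\frac1{l+2}$; in particular $\operatorname{LSdim}(A)>0$. 2. Let $A^*=\operatorname{Hom}_k(A,k)$ be the Serre bimodule, with $(a\cdot f\cdot b)(x)=f(bxa)$. Its $(l+2)$-fold underived tensor power over $A$ vanishes: $$(A^*)^{\otimes_A(l+2)}=A^*\otimes_A\cdots\otimes_AA^*=0.$$ -/

import Mathlib

open CategoryTheory Filter

universe u v w u'

noncomputable section

/-! ### Path algebras of finite quivers -/

/-- All paths of the quiver `V`, with arbitrary source and target. -/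
abbrev QuiverPath (V : Type v) [Quiver.{w} V] : Type (max v w) :=
  Σ a b : V, Quiver.Path a b

/-- The path algebra `kΓ`: the `k`-vector space with basis all paths of the quiver. -/
def PathAlgebra (k : Type u) [Field k] (V : Type v) [Quiver.{w} V] : Type (max u v w) :=
  QuiverPath V →₀ k

namespace PathAlgebra

section Basis

variable (k : Type u) [Field k] (V : Type v) [Quiver.{w} V]

instance : AddCommGroup (PathAlgebra k V) := inferInstanceAs (AddCommGroup (QuiverPath V →₀ k))

instance : Module k (PathAlgebra k V) := inferInstanceAs (Module k (QuiverPath V →₀ k))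

/-- The basis of the path algebra formed by the paths. -/
def pathBasis : Module.Basis (QuiverPath V) k (PathAlgebra k V) :=
  Module.Basis.ofRepr (LinearEquiv.refl k (QuiverPath V →₀ k))

variable {V}

/-- The basis element given by a path. -/
def ofPath (p : QuiverPath V) : PathAlgebra k V := pathBasis k V p

variable {k}

theorem induction_ofPath {P : PathAlgebra k V → Prop} (x : PathAlgebra k V)
    (path : ∀ p, P (ofPath k p)) (zero : P 0) (add : ∀ x y, P x → P y → P (x + y))
    (smul : ∀ (c : k) x, P x → P (c • x)) : P x := by
  have hx : x ∈ Submodule.span k (Set.range (pathBasis k V)) := by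
    rw [(pathBasis k V).span_eq]
    trivial
  induction hx using Submodule.span_induction with
  | mem y hy =>
    obtain ⟨p, rfl⟩ := hy
    exact path p
  | zero => exact zero
  | add y z _ _ hy hz => exact add y z hy hz
  | smul c y _ hy => exact smul c y hy

end Basis

section Mul

variable (k : Type u) [Field k] {V : Type v} [Quiver.{w} V] [DecidableEq V]

/-- The product `pq` of two paths: first follow `q`, then `p`, if the target of `q` is the source
of `p`; otherwise the product is zero. -/
def mulPath : QuiverPath V → QuiverPath V → PathAlgebra k V
  | ⟨b, c, p⟩, ⟨a, b', q⟩ => if h : b = b' then ofPath k ⟨a, c, (h ▸ q).comp p⟩ else 0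

variable (V) in
/-- The bilinear extension of the product of paths. -/
def mulLin : PathAlgebra k V →ₗ[k] PathAlgebra k V →ₗ[k] PathAlgebra k V :=
  (pathBasis k V).constr k fun p => (pathBasis k V).constr k fun q => mulPath k p q

instance : Mul (PathAlgebra k V) := ⟨fun x y => mulLin k V x y⟩

/-- The identity of the path algebra is the sum of all paths of length `0`. -/
instance [Fintype V] : One (PathAlgebra k V) :=
  ⟨∑ x : V, ofPath k ⟨x, x, Quiver.Path.nil⟩⟩

variable {k}

theorem ofPath_mul_ofPath (p q : QuiverPath V) : ofPath k p * ofPath k q = mulPath k p q := by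
  change mulLin k V (pathBasis k V p) (pathBasis k V q) = _
  simp [mulLin]

theorem ofPath_mul_ofPath_comp {a b c : V} (q : Quiver.Path a b) (p : Quiver.Path b c) :
    (ofPath k ⟨b, c, p⟩ : PathAlgebra k V) * ofPath k ⟨a, b, q⟩ = ofPath k ⟨a, c, q.comp p⟩ := by
  simp [ofPath_mul_ofPath, mulPath]

theorem ofPath_mul_ofPath_of_ne {a b b' c : V} (q : Quiver.Path a b') (p : Quiver.Path b c)
    (h : b ≠ b') : (ofPath k ⟨b, c, p⟩ : PathAlgebra k V) * ofPath k ⟨a, b', q⟩ = 0 := by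
  simp [ofPath_mul_ofPath, mulPath, h]

theorem mul_assoc_ofPath (p q r : QuiverPath V) :
    (ofPath k p * ofPath k q) * ofPath k r = ofPath k p * (ofPath k q * ofPath k r) := by
  have hz (x : PathAlgebra k V) : 0 * x = 0 := LinearMap.map_zero₂ (mulLin k V) x
  have hz' (x : PathAlgebra k V) : x * 0 = 0 := map_zero (mulLin k V x)
  obtain ⟨c, d, p⟩ := p
  obtain ⟨b, c', q⟩ := q
  obtain ⟨a, b', r⟩ := r
  by_cases h : c = c'
  · subst h
    by_cases h' : b = b'
    · subst h'
      simp [ofPath_mul_ofPath_comp]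
    · simp [ofPath_mul_ofPath_comp, ofPath_mul_ofPath_of_ne _ _ h', hz']
  · by_cases h' : b = b'
    · subst h'
      simp [ofPath_mul_ofPath_comp, ofPath_mul_ofPath_of_ne _ _ h, hz]
    · simp [ofPath_mul_ofPath_of_ne _ _ h, ofPath_mul_ofPath_of_ne _ _ h', hz, hz']

theorem mul_assoc' (x y z : PathAlgebra k V) : x * y * z = x * (y * z) := by
  have hadd (x y z : PathAlgebra k V) : (x + y) * z = x * z + y * z :=
    LinearMap.map_add₂ (mulLin k V) x y z
  have hadd' (x y z : PathAlgebra k V) : x * (y + z) = x * y + x * z :=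
    map_add (mulLin k V x) y z
  have hsmul (c : k) (x y : PathAlgebra k V) : (c • x) * y = c • (x * y) :=
    LinearMap.map_smul₂ (mulLin k V) c x y
  have hsmul' (c : k) (x y : PathAlgebra k V) : x * (c • y) = c • (x * y) :=
    map_smul (mulLin k V x) c y
  have hz (x : PathAlgebra k V) : 0 * x = 0 := LinearMap.map_zero₂ (mulLin k V) x
  have hz' (x : PathAlgebra k V) : x * 0 = 0 := map_zero (mulLin k V x)
  induction x using induction_ofPath with
  | zero => rw [hz, hz, hz]
  | add x x' hx hx' => rw [hadd, hadd, hadd, hx, hx']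
  | smul c x hx => rw [hsmul, hsmul, hsmul, hx]
  | path p =>
    induction y using induction_ofPath with
    | zero => rw [hz', hz, hz']
    | add y y' hy hy' => rw [hadd', hadd, hadd, hadd', hy, hy']
    | smul c y hy => rw [hsmul', hsmul, hsmul, hsmul', hy]
    | path q =>
      induction z using induction_ofPath with
      | zero => rw [hz', hz', hz']
      | add z z' hz hz' => rw [hadd', hadd', hadd', hz, hz']
      | smul c z hz => rw [hsmul', hsmul', hsmul', hz]
      | path r => exact mul_assoc_ofPath p q r

theorem one_mul' [Fintype V] (x : PathAlgebra k V) : 1 * x = x := by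
  have h : mulLin k V 1 = LinearMap.id := by
    refine (pathBasis k V).ext fun ⟨a, b, p⟩ => ?_
    have h1 : mulLin k V 1 = ∑ x : V, mulLin k V (ofPath k ⟨x, x, Quiver.Path.nil⟩) :=
      map_sum (mulLin k V) _ _
    rw [h1, LinearMap.sum_apply, Finset.sum_eq_single b]
    · exact ofPath_mul_ofPath_comp p Quiver.Path.nil
    · intro c _ hc
      exact ofPath_mul_ofPath_of_ne p Quiver.Path.nil hc
    · simp
  exact LinearMap.congr_fun h x

theorem mul_one' [Fintype V] (x : PathAlgebra k V) : x * 1 = x := by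
  have h : (mulLin k V).flip 1 = LinearMap.id := by
    refine (pathBasis k V).ext fun ⟨a, b, p⟩ => ?_
    have h1 : (mulLin k V).flip 1 =
        ∑ x : V, (mulLin k V).flip (ofPath k ⟨x, x, Quiver.Path.nil⟩) :=
      map_sum (mulLin k V).flip _ _
    rw [h1, LinearMap.sum_apply, Finset.sum_eq_single a]
    · have h2 := ofPath_mul_ofPath_comp (k := k) (Quiver.Path.nil : Quiver.Path a a) p
      rw [Quiver.Path.nil_comp] at h2
      exact h2
    · intro c _ hc
      exact ofPath_mul_ofPath_of_ne Quiver.Path.nil p (Ne.symm hc)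
    · simp
  exact LinearMap.congr_fun h x

instance [Fintype V] : Ring (PathAlgebra k V) :=
  { (inferInstance : AddCommGroup (PathAlgebra k V)),
    (inferInstance : Mul (PathAlgebra k V)),
    (inferInstance : One (PathAlgebra k V)) with
    left_distrib := fun x y z => map_add (mulLin k V x) y z
    right_distrib := fun x y z => LinearMap.map_add₂ (mulLin k V) x y z
    zero_mul := fun x => LinearMap.map_zero₂ (mulLin k V) x
    mul_zero := fun x => map_zero (mulLin k V x)
    mul_assoc := mul_assoc'
    one_mul := one_mul'
    mul_one := mul_one' }

instance [Fintype V] : Algebra k (PathAlgebra k V) :=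
  Algebra.ofModule (fun c x y => LinearMap.map_smul₂ (mulLin k V) c x y)
    (fun c x y => map_smul (mulLin k V x) c y)

variable (k V) in
/-- The span of the paths of positive length; it is a two-sided ideal `R` of `kΓ`. -/
def arrowIdeal : Submodule k (PathAlgebra k V) :=
  Submodule.span k {x | ∃ p : QuiverPath V, 0 < p.2.2.length ∧ x = ofPath k p}

/-- A two-sided ideal of `kΓ` is an ideal of relations if it is contained in `R²`
(equivalently, if it is generated by elements of `R²`). -/
def IsIdealOfRelations [Fintype V] (I : TwoSidedIdeal (PathAlgebra k V)) : Prop :=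
  ∀ x ∈ I, x ∈ arrowIdeal k V ^ 2

/-- The path algebra with relations `kΓ/I`. -/
abbrev WithRelations [Fintype V] (I : TwoSidedIdeal (PathAlgebra k V)) : Type (max u v w) :=
  I.ringCon.Quotient

end Mul

end PathAlgebra

/-- The quiver `V` has length `l`: `l` is the maximal length of its paths. -/
def Quiver.HasLength (V : Type v) [Quiver.{w} V] (l : ℕ) : Prop :=
  IsGreatest {n : ℕ | ∃ (a b : V) (p : Quiver.Path a b), p.length = n} l

/-- A quiver is ordered by a linear order on its vertices if every arrow goes from a smaller
vertex to a larger one. -/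
def Quiver.IsOrdered (V : Type v) [Quiver.{w} V] [LinearOrder V] : Prop :=
  ∀ (a b : V), (a ⟶ b) → a < b

/-- A quiver is connected if its underlying unoriented graph is: it is nonempty, and any two
vertices are joined by a zigzag of arrows. -/
def Quiver.IsConnected (V : Type v) [Quiver.{w} V] : Prop :=
  Nonempty V ∧ Subsingleton (Quiver.WeaklyConnectedComponent V)

/-! ### The Serre bimodule and underived tensor powers of bimodules -/

/-- The Serre bimodule `A^* = Hom_k(A, k)` of the `k`-algebra `A`. -/
def SerreBimodule (k : Type u) [Field k] (A : Type v) [Ring A] [Algebra k A] : Type (max u v) :=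
  A →ₗ[k] k

namespace SerreBimodule

variable (k : Type u) [Field k] (A : Type v) [Ring A] [Algebra k A]

instance : AddCommGroup (SerreBimodule k A) := inferInstanceAs (AddCommGroup (A →ₗ[k] k))

instance : Module k (SerreBimodule k A) := inferInstanceAs (Module k (A →ₗ[k] k))

instance : FunLike (SerreBimodule k A) A k := inferInstanceAs (FunLike (A →ₗ[k] k) A k)

/-- The left action of `A` on `A^*`: `(a f)(x) = f(x a)`. -/
instance : Module A (SerreBimodule k A) where
  smul a f := LinearMap.comp (f : A →ₗ[k] k) (LinearMap.mulRight k a)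
  one_smul f := DFunLike.ext _ _ fun x => congrArg f (mul_one x)
  mul_smul a b f := DFunLike.ext _ _ fun x => congrArg f (mul_assoc x a b).symm
  smul_zero _ := rfl
  smul_add _ _ _ := rfl
  add_smul a b f := DFunLike.ext _ _ fun x =>
    (congrArg f (mul_add x a b)).trans (LinearMap.map_add (f : A →ₗ[k] k) _ _)
  zero_smul f := DFunLike.ext _ _ fun x =>
    (congrArg f (mul_zero x)).trans (LinearMap.map_zero (f : A →ₗ[k] k))

/-- The right action of `A` on `A^*`: `(f b)(x) = f(b x)`. -/
instance : Module Aᵐᵒᵖ (SerreBimodule k A) where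
  smul b f := LinearMap.comp (f : A →ₗ[k] k) (LinearMap.mulLeft k b.unop)
  one_smul f := DFunLike.ext _ _ fun x => congrArg f (one_mul x)
  mul_smul a b f := DFunLike.ext _ _ fun x => congrArg f (mul_assoc b.unop a.unop x)
  smul_zero _ := rfl
  smul_add _ _ _ := rfl
  add_smul a b f := DFunLike.ext _ _ fun x =>
    (congrArg f (add_mul a.unop b.unop x)).trans (LinearMap.map_add (f : A →ₗ[k] k) _ _)
  zero_smul f := DFunLike.ext _ _ fun x =>
    (congrArg f (zero_mul x)).trans (LinearMap.map_zero (f : A →ₗ[k] k))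

variable {k A}

theorem smul_apply (a : A) (f : SerreBimodule k A) (x : A) : (a • f) x = f (x * a) := rfl

theorem op_smul_apply (b : A) (f : SerreBimodule k A) (x : A) :
    (MulOpposite.op b • f) x = f (b * x) := rfl

end SerreBimodule

section TensorPower

variable (k : Type u) [Field k] (A : Type v) [Ring A]
  (B : Type w) [AddCommGroup B] [Module k B] [Module A B] [Module Aᵐᵒᵖ B]

/-- For an `A`-bimodule `B`, the subspace of the `r`-fold tensor power of `B` over `k` spanned by
the elements `… ⊗ fᵢ a ⊗ fᵢ₊₁ ⊗ … - … ⊗ fᵢ ⊗ a fᵢ₊₁ ⊗ …`. -/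
def balancedRelations (r : ℕ) : Submodule k (PiTensorProduct k fun _ : Fin r => B) :=
  Submodule.span k {t | ∃ (f : Fin r → B) (i j : Fin r) (a : A), (j : ℕ) = i + 1 ∧
    t = PiTensorProduct.tprod k (Function.update f i (MulOpposite.op a • f i)) -
      PiTensorProduct.tprod k (Function.update f j (a • f j))}

/-- The `r`-fold underived tensor power `B ⊗_A ⋯ ⊗_A B` of an `A`-bimodule `B`, for `r ≥ 1`. -/
abbrev BimoduleTensorPower (r : ℕ) : Type _ :=
  (PiTensorProduct k fun _ : Fin r => B) ⧸ balancedRelations k A B r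

end TensorPower

/-! ### Perfect complexes, Serre functors and the lower Serre dimension -/

section Perf

variable (A : Type v) [Ring A] [HasDerivedCategory.{u'} (ModuleCat.{v} Aᵐᵒᵖ)]

/-- An object of the derived category `D(A)` of right `A`-modules is perfect if it is isomorphic
there to a bounded complex of finitely generated projective modules. -/
def isPerfect : ObjectProperty (DerivedCategory (ModuleCat.{v} Aᵐᵒᵖ)) := fun X =>
  ∃ K : CochainComplex (ModuleCat.{v} Aᵐᵒᵖ) ℤ,
    (∃ a b : ℤ, ∀ i : ℤ, i < a ∨ b < i → Limits.IsZero (K.X i)) ∧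
    (∀ i : ℤ, Module.Finite Aᵐᵒᵖ (K.X i) ∧ Module.Projective Aᵐᵒᵖ (K.X i)) ∧
    Nonempty (X ≅ DerivedCategory.Q.obj K)

/-- The category `Perf A`, a full subcategory of the derived category of right `A`-modules. -/
abbrev Perf := (isPerfect A).FullSubcategory

variable {A}

/-- `G` is a classical generator of `Perf A`: every perfect complex is obtained from `G` by
finitely many shifts, finite direct sums, extensions and direct summands. -/
def IsClassicalGenerator (G : Perf A) : Prop :=
  ∀ X : Perf A, (ObjectProperty.singleton G.obj).triangEnvelope X.obj

/-- `sup Hom^•(X, Y)`, the supremum (in `[-∞, ∞]`) of the integers `i` with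
`Hom(X, Y[i]) ≠ 0`. -/
def supHom (X Y : Perf A) : EReal :=
  sSup {t : EReal | ∃ i : ℤ, Nontrivial (X.obj ⟶ (shiftFunctor _ i).obj Y.obj) ∧
    t = ((i : ℝ) : EReal)}

/-- The lower Serre dimension of `Perf A`, computed with the Serre functor `S` and the classical
generator `G`: the lower limit of `- sup Hom^•(G, S^m G) / m`. -/
def LSdim (S : Perf A ⥤ Perf A) (G : Perf A) : EReal :=
  liminf (fun m : ℕ => -supHom G (S.obj^[m] G) / (m : EReal)) atTop

end Perf

/-- A Serre functor on a `k`-linear category `T`: a functor `S` together with isomorphisms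
`Hom(X, Y) ≅ Hom(Y, S X)^*` of `k`-vector spaces, natural in `X` and `Y`. -/
structure SerreFunctor (k : Type u) [Field k] (T : Type v) [Category.{w} T] [Preadditive T]
    [Linear k T] where
  /-- the underlying functor -/
  functor : T ⥤ T
  /-- the duality isomorphisms -/
  duality (X Y : T) : (X ⟶ Y) ≃ₗ[k] Module.Dual k (Y ⟶ functor.obj X)
  /-- naturality in the first variable -/
  naturality_left {X X' Y : T} (f : X' ⟶ X) (g : X ⟶ Y) (h : Y ⟶ functor.obj X') :
    duality X' Y (f ≫ g) h = duality X Y g (h ≫ functor.map f)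
  /-- naturality in the second variable -/
  naturality_right {X Y Y' : T} (f : X ⟶ Y) (g : Y ⟶ Y') (h : Y' ⟶ functor.obj X) :
    duality X Y' (f ≫ g) h = duality X Y f (g ≫ h)

end

noncomputable section

set_option linter.unusedSectionVars false

open Limits Pretriangulated ZeroObject

/-! ### Linear algebra of pairings -/

section LinearAlgebra

variable {k : Type*} [Field k] {M N M₁ M₂ M₃ : Type*} [AddCommGroup M] [Module k M]
  [AddCommGroup N] [Module k N] [AddCommGroup M₁] [Module k M₁] [AddCommGroup M₂] [Module k M₂]
  [AddCommGroup M₃] [Module k M₃]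

/-! Products of paths are read from right to left, so `e_i A e_j` is spanned by the classes of paths
from `j` to `i`. As arrows increase the order, `e_i A e_j = 0` for `i < j` and `e_i A e_i = k e_i`,
and `A` is finite-dimensional. Filtering by simple modules and inducting on the vertex, every
finitely generated module is built from the `e_i A` by extensions and cones. Hence such modules are
perfect, `A` is a classical generator, and any property stable under shifts and cones need only be
tested on the `e_i A`.

Existence of a Serre functor: the dual of `e_i A` is the module `e_i A^*`, which is perfect, and the
dual of a cone is the cone of the dual map (`hasSerreDual_of_distTriang`). Since morphism spaces are
finite-dimensional, these representing objects assemble into a functor (`nonempty_serreFunctor`).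

Lower bound: any Serre functor `S` is right t-exact, since a map from `A` in degree `i` to `S X` is
dual to a map from `X` to `A` in degree `i`. Moreover `Hom(A, S A)` is the bimodule `A^*`. If `X`
lies in degrees `≤ n`, maps `X → A[-n]` are detected by maps `A[-n] → X`. By duality, all maps
`A[-n] → S^m X` are then spanned by composites of `m` elements of `A^*` with a map `A[-n] → X`.
These composites are balanced over `A`, so they vanish once the `m`-fold tensor power of `A^*` does
(`SerreFunctor.subsingleton_hom_iter`). If the `r`-fold power is zero, `S^r` therefore lowers the
upper cohomological bound by one, and `S^m G` lies in degrees `≤ n - ⌊m/r⌋`. Maps from the perfect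
object `G` to sufficiently negative objects are zero, so the lower Serre dimension is at least
`1/r`.

Vanishing for `r = l + 2`: in a pure tensor, a factor in `e_i A^*` with `i` not a sink can be
rewritten so that the next factor lies in `e_j A^*` with `j` of greater depth, the depth being the
maximal length of a path ending at the vertex. Depth is at most `l`, so this stops at a sink. There
connectedness supplies an incoming arrow, whose class is nonzero because `I ⊂ R²`, and moving that
arrow across the tensor sign kills the tensor (`subsingleton_bimoduleTensorPower`). -/

theorem exists_dual_comp_eq (L : M →ₗ[k] N) (f : Module.Dual k M)
    (h : ∀ x, L x = 0 → f x = 0) : ∃ g : Module.Dual k N, ∀ x, g (L x) = f x := by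
  have hf : f ∈ LinearMap.range L.dualMap := by
    rw [LinearMap.range_dualMap_eq_dualAnnihilator_ker, Submodule.mem_dualAnnihilator]
    exact fun x hx => h x (LinearMap.mem_ker.1 hx)
  obtain ⟨g, rfl⟩ := hf
  exact ⟨g, fun x => rfl⟩

theorem exact_dualMap {f : M₁ →ₗ[k] M₂} {g : M₂ →ₗ[k] M₃} (h : Function.Exact f g) :
    Function.Exact g.dualMap f.dualMap := by
  intro φ
  constructor
  · intro hφ
    obtain ⟨ψ, hψ⟩ := exists_dual_comp_eq g φ fun x hx => by
      obtain ⟨y, rfl⟩ := (h x).1 hx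
      exact LinearMap.congr_fun hφ y
    exact ⟨ψ, LinearMap.ext hψ⟩
  · rintro ⟨ψ, rfl⟩
    ext x
    simp [h.apply_apply_eq_zero]

/-- The flip is the transpose of `B` preceded by the biduality isomorphism of `N`. This lets a
pairing be checked on one side only. -/
theorem flip_bijective_of_bijective [FiniteDimensional k N] (B : M →ₗ[k] Module.Dual k N)
    (hB : Function.Bijective B) : Function.Bijective B.flip := by
  let e := LinearEquiv.ofBijective B hB
  have : FiniteDimensional k M := e.symm.finiteDimensional
  have : B.flip = (e.dualMap.toLinearMap) ∘ₗ (Module.evalEquiv k N).toLinearMap := by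
    ext x y
    rfl
  rw [this]
  exact e.dualMap.bijective.comp (Module.evalEquiv k N).bijective

end LinearAlgebra

/-! ### Serre duals in linear triangulated categories -/

section SerreDual

variable {k : Type u} [Field k] {T : Type v} [Category.{w} T] [Preadditive T] [Linear k T]

variable (k) in
/-- A fully faithful linear functor induces linear equivalences on morphisms. -/
def homLinearEquivOfFullyFaithful {T' : Type*} [Category T'] [Preadditive T']
    [Linear k T'] (F : T ⥤ T') [F.Additive] [F.Linear k] [F.Full] [F.Faithful] (X Y : T) :
    (X ⟶ Y) ≃ₗ[k] (F.obj X ⟶ F.obj Y) :=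
  LinearEquiv.ofBijective (F.mapLinearMap k) ⟨F.map_injective, F.map_surjective⟩

@[simp]
theorem homLinearEquivOfFullyFaithful_symm_map {T' : Type*} [Category T']
    [Preadditive T'] [Linear k T'] (F : T ⥤ T') [F.Additive] [F.Linear k] [F.Full] [F.Faithful]
    {X Y : T} (f : X ⟶ Y) : (homLinearEquivOfFullyFaithful k F X Y).symm (F.map f) = f :=
  (homLinearEquivOfFullyFaithful k F X Y).symm_apply_apply f

/-- The pairing `Hom(Y, Z) → Hom(X, Y)^*` induced by a functional on `Hom(X, Z)`. -/
def serrePairing {X Z : T} (φ : (X ⟶ Z) →ₗ[k] k) (Y : T) : (Y ⟶ Z) →ₗ[k] Module.Dual k (X ⟶ Y) :=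
  ((Linear.comp X Y Z : (X ⟶ Y) →ₗ[k] (Y ⟶ Z) →ₗ[k] (X ⟶ Z)).flip).compr₂ φ

@[simp]
theorem serrePairing_apply {X Y Z : T} (φ : (X ⟶ Z) →ₗ[k] k) (h : Y ⟶ Z) (g : X ⟶ Y) :
    serrePairing φ Y h g = φ (g ≫ h) := rfl

theorem serrePairing_bijective_of_iso {X Z Y Y' : T} (φ : (X ⟶ Z) →ₗ[k] k) (e : Y ≅ Y')
    (h : Function.Bijective (serrePairing φ Y)) : Function.Bijective (serrePairing φ Y') := by
  have : serrePairing φ Y' = ((Linear.homCongr k (Iso.refl X) e).symm.dualMap.toLinearMap) ∘ₗ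
      serrePairing φ Y ∘ₗ (Linear.homCongr k e (Iso.refl Z)).symm.toLinearMap := by
    ext f g
    simp [Linear.homCongr_symm_apply]
  rw [this, LinearMap.coe_comp, LinearMap.coe_comp]
  exact (LinearEquiv.bijective _).comp (h.comp (LinearEquiv.bijective _))

variable (k) in
/-- `X` has a Serre dual in `P` if the functor `Hom(X, -)^*` on `P` is represented by an object
of `P`. -/
def HasSerreDual (P : ObjectProperty T) : ObjectProperty T := fun X =>
  ∃ (Z : T) (φ : (X ⟶ Z) →ₗ[k] k), P Z ∧ ∀ Y, P Y → Function.Bijective (serrePairing φ Y)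

instance (P : ObjectProperty T) : (HasSerreDual k P).IsClosedUnderIsomorphisms where
  of_iso := by
    rintro X X' e ⟨Z, φ, hZ, h⟩
    refine ⟨Z, φ ∘ₗ (Linear.homCongr k e (Iso.refl Z)).symm.toLinearMap, hZ, fun Y hY => ?_⟩
    have : serrePairing (φ ∘ₗ (Linear.homCongr k e (Iso.refl Z)).symm.toLinearMap) Y =
        ((Linear.homCongr k e (Iso.refl Y)).symm.dualMap.toLinearMap) ∘ₗ serrePairing φ Y := by
      ext f g
      simp [Linear.homCongr_symm_apply]
    rw [this, LinearMap.coe_comp]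
    exact (LinearEquiv.bijective _).comp (h Y hY)

/-- If every object of `P` has a Serre dual in `P` and the spaces of morphisms are
finite-dimensional, then `P` has a Serre functor. -/
theorem nonempty_serreFunctor (P : ObjectProperty T)
    (hP : ∀ X, P X → HasSerreDual k P X)
    (hfin : ∀ X Y, P X → P Y → FiniteDimensional k (X ⟶ Y)) :
    Nonempty (SerreFunctor k P.FullSubcategory) := by
  choose Z φ hZ hφ using hP
  let R : P.FullSubcategory → P.FullSubcategory := fun X => ⟨Z X.obj X.property, hZ _ _⟩
  -- The value of the Serre functor on `f`: the functional `g ↦ φ (f ≫ g)` is represented because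
  -- the pairing of `X'` is surjective. Injectivity makes the representative unique, which gives
  -- functoriality.
  have hmap (X X' : P.FullSubcategory) (f : X ⟶ X') : ∃ s : (R X).obj ⟶ (R X').obj,
      ∀ g : X'.obj ⟶ (R X).obj, φ X'.obj X'.property (g ≫ s) = φ X.obj X.property (f.hom ≫ g) := by
    obtain ⟨s, hs⟩ := (hφ X'.obj X'.property (R X).obj (R X).property).2
      (φ X.obj X.property ∘ₗ Linear.leftComp k _ f.hom)
    exact ⟨s, fun g => LinearMap.congr_fun hs g⟩
  choose s hs using hmap
  have huniq (X Y : P.FullSubcategory) (a b : Y.obj ⟶ (R X).obj)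
      (h : ∀ g : X.obj ⟶ Y.obj, φ X.obj X.property (g ≫ a) = φ X.obj X.property (g ≫ b)) :
      a = b := (hφ X.obj X.property Y.obj Y.property).1 (LinearMap.ext h)
  let S : P.FullSubcategory ⥤ P.FullSubcategory :=
    { obj := R
      map := fun {X X'} f => ObjectProperty.homMk (s X X' f)
      map_id := fun X => by
        ext
        apply huniq
        intro g
        change φ _ _ (g ≫ s X X (𝟙 X)) = φ _ _ (g ≫ 𝟙 _)
        rw [hs]
        simp
      map_comp := fun {X Y W} f g => by
        ext
        apply huniq
        intro h
        change φ _ _ (h ≫ s X W (f ≫ g)) = φ _ _ (h ≫ s X Y f ≫ s Y W g)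
        rw [hs, ← Category.assoc, hs, ← Category.assoc, hs]
        simp }
  have hfin' (X Y : P.FullSubcategory) : FiniteDimensional k (X.obj ⟶ Y.obj) :=
    hfin _ _ X.property Y.property
  have hbij (X Y : P.FullSubcategory) :
      Function.Bijective (serrePairing (φ X.obj X.property) Y.obj).flip :=
    flip_bijective_of_bijective _ (hφ X.obj X.property Y.obj Y.property)
  let D (X Y : P.FullSubcategory) : (X ⟶ Y) ≃ₗ[k] Module.Dual k (Y ⟶ S.obj X) :=
    (homLinearEquivOfFullyFaithful k P.ι X Y).trans
      ((LinearEquiv.ofBijective _ (hbij X Y)).trans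
        (homLinearEquivOfFullyFaithful k P.ι Y (S.obj X)).dualMap)
  exact ⟨
    { functor := S
      duality := D
      naturality_left := fun {X X' Y} f g h => by
        change φ _ _ ((f.hom ≫ g.hom) ≫ h.hom) = φ _ _ (g.hom ≫ h.hom ≫ s X' X f)
        rw [← Category.assoc g.hom, hs, Category.assoc]
      naturality_right := fun {X Y Y'} f g h => by
        change φ _ _ ((f.hom ≫ g.hom) ≫ h.hom) = φ _ _ (f.hom ≫ g.hom ≫ h.hom)
        rw [Category.assoc] }⟩

/-- A functional on `Hom(X, Z)`, transported by a fully faithful functor. -/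
def mapFunctional {T' : Type*} [Category T'] [Preadditive T'] [Linear k T'] (F : T ⥤ T')
    [F.Additive] [F.Linear k] [F.Full] [F.Faithful] {X Z : T} (φ : (X ⟶ Z) →ₗ[k] k) :
    (F.obj X ⟶ F.obj Z) →ₗ[k] k :=
  φ ∘ₗ (homLinearEquivOfFullyFaithful k F X Z).symm.toLinearMap

@[simp]
theorem mapFunctional_map {T' : Type*} [Category T'] [Preadditive T'] [Linear k T'] (F : T ⥤ T')
    [F.Additive] [F.Linear k] [F.Full] [F.Faithful] {X Z : T} (φ : (X ⟶ Z) →ₗ[k] k)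
    (f : X ⟶ Z) : mapFunctional F φ (F.map f) = φ f := by
  simp [mapFunctional]

theorem serrePairing_mapFunctional_bijective {T' : Type*} [Category T'] [Preadditive T']
    [Linear k T'] (F : T ⥤ T') [F.Additive] [F.Linear k] [F.Full] [F.Faithful] {X Y Z : T}
    (φ : (X ⟶ Z) →ₗ[k] k) (h : Function.Bijective (serrePairing φ Y)) :
    Function.Bijective (serrePairing (mapFunctional F φ) (F.obj Y)) := by
  have : serrePairing (mapFunctional F φ) (F.obj Y) =
      (homLinearEquivOfFullyFaithful k F X Y).symm.dualMap.toLinearMap ∘ₗ serrePairing φ Y ∘ₗ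
        (homLinearEquivOfFullyFaithful k F Y Z).symm.toLinearMap := by
    ext f g
    obtain ⟨f, rfl⟩ := F.map_surjective f
    obtain ⟨g, rfl⟩ := F.map_surjective g
    rw [serrePairing_apply, ← F.map_comp, mapFunctional_map]
    simp
  rw [this, LinearMap.coe_comp, LinearMap.coe_comp]
  exact (LinearEquiv.bijective _).comp (h.comp (LinearEquiv.bijective _))

/-! ### Serre duality and distinguished triangles. -/

section Triangulated

variable [HasZeroObject T] [HasShift T ℤ] [∀ n : ℤ, (shiftFunctor T n).Additive]
  [∀ n : ℤ, (shiftFunctor T n).Linear k] [Pretriangulated T]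

theorem exact_rightComp_mor₂ {Δ : Triangle T} (hΔ : Δ ∈ distTriang T) (W : T) :
    Function.Exact (Linear.rightComp k W Δ.mor₁) (Linear.rightComp k W Δ.mor₂) := by
  intro f
  constructor
  · intro hf
    obtain ⟨g, rfl⟩ := Triangle.coyoneda_exact₂ Δ hΔ f hf
    exact ⟨g, rfl⟩
  · rintro ⟨g, rfl⟩
    simp [comp_distTriang_mor_zero₁₂ Δ hΔ]

theorem exact_leftComp_mor₁ {Δ : Triangle T} (hΔ : Δ ∈ distTriang T) (W : T) :
    Function.Exact (Linear.leftComp k W Δ.mor₂) (Linear.leftComp k W Δ.mor₁) := by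
  intro f
  constructor
  · intro hf
    obtain ⟨g, rfl⟩ := Triangle.yoneda_exact₂ Δ hΔ f hf
    exact ⟨g, rfl⟩
  · rintro ⟨g, rfl⟩
    simp [comp_distTriang_mor_zero₁₂_assoc Δ hΔ]

theorem exact_rightComp_mor₃ {Δ : Triangle T} (hΔ : Δ ∈ distTriang T) (W : T) :
    Function.Exact (Linear.rightComp k W Δ.mor₂) (Linear.rightComp k W Δ.mor₃) :=
  exact_rightComp_mor₂ (rot_of_distTriang Δ hΔ) W

theorem exact_leftComp_mor₂ {Δ : Triangle T} (hΔ : Δ ∈ distTriang T) (W : T) :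
    Function.Exact (Linear.leftComp k W Δ.mor₃) (Linear.leftComp k W Δ.mor₂) :=
  exact_leftComp_mor₁ (rot_of_distTriang Δ hΔ) W

/-- Rotating twice produces the map `-Δ.mor₁⟦1⟧`; the sign affects neither kernel nor image. -/
theorem exact_rightComp_shift {Δ : Triangle T} (hΔ : Δ ∈ distTriang T) (W : T) :
    Function.Exact (Linear.rightComp k W Δ.mor₃)
      (Linear.rightComp k W ((shiftFunctor T (1 : ℤ)).map Δ.mor₁)) := by
  have h := exact_rightComp_mor₃ (k := k) (rot_of_distTriang Δ hΔ) W
  intro f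
  refine Iff.trans ?_ (h f)
  change f ≫ _ = 0 ↔ f ≫ (-(shiftFunctor T (1 : ℤ)).map Δ.mor₁) = 0
  exact (neg_eq_zero.symm.trans (by rw [← Preadditive.comp_neg]))

theorem exact_leftComp_shift {Δ : Triangle T} (hΔ : Δ ∈ distTriang T) (W : T) :
    Function.Exact (Linear.leftComp k W ((shiftFunctor T (1 : ℤ)).map Δ.mor₁))
      (Linear.leftComp k W Δ.mor₃) := by
  have h := exact_leftComp_mor₂ (k := k) (rot_of_distTriang Δ hΔ) W
  intro f
  refine (h f).trans ⟨?_, ?_⟩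
  · rintro ⟨g, rfl⟩
    exact ⟨-g, (Preadditive.comp_neg _ _).trans (Preadditive.neg_comp _ _).symm⟩
  · rintro ⟨g, rfl⟩
    exact ⟨-g, Preadditive.neg_comp_neg _ _⟩

instance (P : ObjectProperty T) [P.IsStableUnderShift ℤ] [P.IsClosedUnderIsomorphisms] :
    (HasSerreDual k P).IsStableUnderShift ℤ where
  isStableUnderShiftBy n :=
    { le_shift := by
        rintro X ⟨Z, φ, hZ, h⟩
        refine ⟨(shiftFunctor T n).obj Z, mapFunctional (shiftFunctor T n) φ, P.le_shift n _ hZ,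
          fun Y hY => ?_⟩
        exact serrePairing_bijective_of_iso _ ((shiftEquiv T n).counitIso.app Y)
          (serrePairing_mapFunctional_bijective _ _ (h _ (P.le_shift (-n) _ hY))) }

/-- The functional on morphisms between the cones in the construction of Serre duals of cones. -/
theorem exists_functional_of_distTriang {Δ Δ' : Triangle T} (hΔ : Δ ∈ distTriang T)
    (hΔ' : Δ' ∈ distTriang T) (φ₁ : (Δ.obj₁ ⟶ Δ'.obj₁) →ₗ[k] k) (φ₂ : (Δ.obj₂ ⟶ Δ'.obj₂) →ₗ[k] k)
    (h : ∀ g : Δ.obj₂ ⟶ Δ'.obj₁, φ₂ (g ≫ Δ'.mor₁) = φ₁ (Δ.mor₁ ≫ g)) :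
    ∃ ψ : (Δ.obj₃ ⟶ Δ'.obj₃) →ₗ[k] k,
      (∀ g : Δ.obj₃ ⟶ Δ'.obj₂, ψ (g ≫ Δ'.mor₂) = φ₂ (Δ.mor₂ ≫ g)) ∧
      (∀ g : Δ.obj₁⟦(1 : ℤ)⟧ ⟶ Δ'.obj₃, ψ (Δ.mor₃ ≫ g) =
        - mapFunctional (shiftFunctor T (1 : ℤ)) φ₁ (g ≫ Δ'.mor₃)) := by
  -- The two conditions prescribe `ψ` on the images of two maps into `Hom(Δ.obj₃, Δ'.obj₃)`. An
  -- extension exists as soon as the prescriptions agree on relations `a ≫ Δ'.mor₂ + Δ.mor₃ ≫ b =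
  -- 0`.
  obtain ⟨ψ, hψ⟩ := exists_dual_comp_eq
    ((Linear.rightComp k Δ.obj₃ Δ'.mor₂).coprod (Linear.leftComp k Δ'.obj₃ Δ.mor₃))
    ((φ₂ ∘ₗ Linear.leftComp k Δ'.obj₂ Δ.mor₂).coprod
      (-(mapFunctional (shiftFunctor T (1 : ℤ)) φ₁ ∘ₗ Linear.rightComp k _ Δ'.mor₃))) (by
    rintro ⟨a, b⟩ hab
    simp only [LinearMap.coprod_apply, Linear.rightComp_apply, Linear.leftComp_apply] at hab
    -- The relation says that `-a` and `b` form a commutative square between the rotated triangles.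
    -- The completing map `c` expresses both `Δ.mor₂ ≫ a` and `b ≫ Δ'.mor₃`, and `h` compares the
    -- two resulting values.
    have hc : ∃ c : Δ.obj₂⟦(1 : ℤ)⟧ ⟶ Δ'.obj₁⟦(1 : ℤ)⟧,
        (-Δ.mor₁⟦(1 : ℤ)⟧') ≫ c = b ≫ Δ'.mor₃ ∧
        (-Δ.mor₂⟦(1 : ℤ)⟧') ≫ (-a)⟦(1 : ℤ)⟧' = c ≫ (-Δ'.mor₁⟦(1 : ℤ)⟧') :=
      complete_distinguished_triangle_morphism _ _
        (rot_of_distTriang _ (rot_of_distTriang _ hΔ)) (rot_of_distTriang _ hΔ') (-a) b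
        ((eq_neg_of_add_eq_zero_right hab).trans (Preadditive.neg_comp _ _).symm)
    obtain ⟨c, hc₁, hc₂⟩ := hc
    obtain ⟨c, rfl⟩ := (shiftFunctor T (1 : ℤ)).map_surjective c
    have hc₃ : Δ.mor₂ ≫ a = - (c ≫ Δ'.mor₁) := by
      apply (shiftFunctor T (1 : ℤ)).map_injective
      simpa using hc₂
    simp only [LinearMap.coprod_apply, LinearMap.comp_apply, Linear.rightComp_apply,
      Linear.leftComp_apply, LinearMap.neg_apply]
    rw [hc₃, ← hc₁, map_neg, h, Preadditive.neg_comp, ← Functor.map_comp, map_neg,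
      mapFunctional_map]
    simp)
  refine ⟨ψ, fun g => ?_, fun g => ?_⟩
  · simpa using hψ (g, 0)
  · simpa using hψ (0, g)

/-- The transpose `s` of `Δ.mor₁` is a map between the duals of the first two vertices, and its cone
is dual to the third. The functional on the cone is not canonical, but any compatible choice makes
the five lemma applicable. -/
theorem hasSerreDual_of_distTriang (P : ObjectProperty T) [P.IsTriangulated]
    [P.IsClosedUnderIsomorphisms] {Δ : Triangle T} (hΔ : Δ ∈ distTriang T)
    (h₁ : HasSerreDual k P Δ.obj₁) (h₂ : HasSerreDual k P Δ.obj₂) : HasSerreDual k P Δ.obj₃ := by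
  obtain ⟨Z₁, φ₁, hZ₁, hφ₁⟩ := h₁
  obtain ⟨Z₂, φ₂, hZ₂, hφ₂⟩ := h₂
  obtain ⟨s, hs⟩ := (hφ₂ Z₁ hZ₁).2 (φ₁ ∘ₗ Linear.leftComp k _ Δ.mor₁)
  replace hs (g : Δ.obj₂ ⟶ Z₁) : φ₂ (g ≫ s) = φ₁ (Δ.mor₁ ≫ g) := LinearMap.congr_fun hs g
  obtain ⟨C, q, r, hΔ'⟩ := distinguished_cocone_triangle s
  have hψ : ∃ ψ : (Δ.obj₃ ⟶ C) →ₗ[k] k,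
      (∀ g : Δ.obj₃ ⟶ Z₂, ψ (g ≫ q) = φ₂ (Δ.mor₂ ≫ g)) ∧
      (∀ g : Δ.obj₁⟦(1 : ℤ)⟧ ⟶ C, ψ (Δ.mor₃ ≫ g) =
        - mapFunctional (shiftFunctor T (1 : ℤ)) φ₁ (g ≫ r)) :=
    exists_functional_of_distTriang hΔ hΔ' φ₁ φ₂ hs
  obtain ⟨ψ, hψ₁, hψ₂⟩ := hψ
  refine ⟨C, ψ, P.ext_of_isTriangulatedClosed₃ _ hΔ' hZ₁ hZ₂, fun W hW => ?_⟩
  have hshift {X Z : T} (φ : (X ⟶ Z) →ₗ[k] k)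
      (h : ∀ Y, P Y → Function.Bijective (serrePairing φ Y)) :
      Function.Bijective (serrePairing (mapFunctional (shiftFunctor T (1 : ℤ)) φ) W) :=
    serrePairing_bijective_of_iso _ ((shiftEquiv T (1 : ℤ)).counitIso.app W)
      (serrePairing_mapFunctional_bijective _ _ (h _ (P.le_shift (-1) _ hW)))
  have hneg {M N : Type w} [AddCommGroup M] [Module k M] [AddCommGroup N] [Module k N]
      (f : M →ₗ[k] Module.Dual k N) (hf : Function.Bijective f) : Function.Bijective (-f) :=
    (Equiv.neg (Module.Dual k N)).bijective.comp hf
  -- The five lemma compares maps from `W` into the cone triangle with the duals of maps from `Δ` to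
  -- `W`. The last two vertical maps carry a minus sign to match the sign in `hψ₂`.
  refine LinearMap.bijective_of_surjective_of_bijective_of_bijective_of_injective
    (Linear.rightComp k W s) (Linear.rightComp k W q) (Linear.rightComp k W r)
    (Linear.rightComp k W ((shiftFunctor T (1 : ℤ)).map s))
    (Linear.leftComp k W Δ.mor₁).dualMap (Linear.leftComp k W Δ.mor₂).dualMap
    (Linear.leftComp k W Δ.mor₃).dualMap
    (Linear.leftComp k W ((shiftFunctor T (1 : ℤ)).map Δ.mor₁)).dualMap
    (serrePairing φ₁ W) (serrePairing φ₂ W) (serrePairing ψ W)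
    (-serrePairing (mapFunctional (shiftFunctor T (1 : ℤ)) φ₁) W)
    (-serrePairing (mapFunctional (shiftFunctor T (1 : ℤ)) φ₂) W)
    ?_ ?_ ?_ ?_ (exact_rightComp_mor₂ hΔ' W) (exact_rightComp_mor₃ hΔ' W)
    (exact_rightComp_shift hΔ' W)
    (exact_dualMap (exact_leftComp_mor₁ hΔ W)) (exact_dualMap (exact_leftComp_mor₂ hΔ W))
    (exact_dualMap (exact_leftComp_shift hΔ W))
    (hφ₁ W hW).2 (hφ₂ W hW) (hneg _ (hshift φ₁ hφ₁)) (hneg _ (hshift φ₂ hφ₂)).1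
  · ext f g
    simp [← hs]
  · ext f g
    simp [← hψ₁]
  · ext f g
    simp [hψ₂]
  · ext f g
    obtain ⟨a, ha⟩ := (shiftFunctor T (1 : ℤ)).map_surjective (g ≫ f)
    have : mapFunctional (shiftFunctor T (1 : ℤ)) φ₂
        ((g ≫ f) ≫ (shiftFunctor T (1 : ℤ)).map s) =
        mapFunctional (shiftFunctor T (1 : ℤ)) φ₁
          ((shiftFunctor T (1 : ℤ)).map Δ.mor₁ ≫ g ≫ f) := by
      rw [← ha, ← Functor.map_comp, ← Functor.map_comp, mapFunctional_map, mapFunctional_map, hs]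
    simpa using this.symm

instance (P : ObjectProperty T) [P.IsTriangulated] [P.IsClosedUnderIsomorphisms] :
    (HasSerreDual k P).IsTriangulated :=
  have : (HasSerreDual k P).IsTriangulatedClosed₃ :=
    .mk' fun _ hΔ h₁ h₂ => hasSerreDual_of_distTriang P hΔ h₁ h₂
  { toContainsZero :=
      { exists_zero := by
          refine ⟨0, isZero_zero T, 0, 0, P.prop_zero, fun Y hY => ⟨?_, ?_⟩⟩
          · intro f g _
            exact (isZero_zero T).eq_of_tgt _ _
          · intro f
            refine ⟨0, ?_⟩
            ext g
            rw [(isZero_zero T).eq_of_src g 0]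
            simp }
    toIsTriangulatedClosed₂ := .of_isTriangulatedClosed₃ }

/-- The objects on all shifts of which the pairing given by a functional is perfect form a
triangulated subcategory. -/
def serrePairingPerfect {X Z : T} (φ : (X ⟶ Z) →ₗ[k] k) : ObjectProperty T := fun Y =>
  ∀ n : ℤ, Function.Bijective (serrePairing φ (Y⟦n⟧))

instance {X Z : T} (φ : (X ⟶ Z) →ₗ[k] k) :
    (serrePairingPerfect φ).IsClosedUnderIsomorphisms where
  of_iso e h n := serrePairing_bijective_of_iso φ ((shiftFunctor T n).mapIso e) (h n)

instance {X Z : T} (φ : (X ⟶ Z) →ₗ[k] k) : (serrePairingPerfect φ).IsStableUnderShift ℤ where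
  isStableUnderShiftBy n :=
    { le_shift := fun Y hY m => serrePairing_bijective_of_iso φ ((shiftFunctorAdd T n m).app Y)
        (hY (n + m)) }

theorem serrePairingPerfect.bijective {X Z : T} {φ : (X ⟶ Z) →ₗ[k] k} {Y : T}
    (hY : serrePairingPerfect φ Y) : Function.Bijective (serrePairing φ Y) :=
  serrePairing_bijective_of_iso φ ((shiftFunctorZero T ℤ).app Y) (hY 0)

/-- Both sides are contravariant cohomological functors of `Y`, so this is again the five lemma. The
functional is fixed here, hence no signs intervene. -/
theorem serrePairing_bijective_of_distTriang {X Z : T} (φ : (X ⟶ Z) →ₗ[k] k) {Δ : Triangle T}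
    (hΔ : Δ ∈ distTriang T) (h₁ : serrePairingPerfect φ Δ.obj₁)
    (h₂ : serrePairingPerfect φ Δ.obj₂) : Function.Bijective (serrePairing φ Δ.obj₃) := by
  refine LinearMap.bijective_of_surjective_of_bijective_of_bijective_of_injective
    (Linear.leftComp k Z ((shiftFunctor T (1 : ℤ)).map Δ.mor₁))
    (Linear.leftComp k Z Δ.mor₃) (Linear.leftComp k Z Δ.mor₂) (Linear.leftComp k Z Δ.mor₁)
    (Linear.rightComp k X ((shiftFunctor T (1 : ℤ)).map Δ.mor₁)).dualMap
    (Linear.rightComp k X Δ.mor₃).dualMap (Linear.rightComp k X Δ.mor₂).dualMap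
    (Linear.rightComp k X Δ.mor₁).dualMap
    (serrePairing φ _) (serrePairing φ _) (serrePairing φ _) (serrePairing φ _)
    (serrePairing φ _) ?_ ?_ ?_ ?_ (exact_leftComp_shift hΔ Z) (exact_leftComp_mor₂ hΔ Z)
    (exact_leftComp_mor₁ hΔ Z) (exact_dualMap (exact_rightComp_shift hΔ X))
    (exact_dualMap (exact_rightComp_mor₃ hΔ X)) (exact_dualMap (exact_rightComp_mor₂ hΔ X))
    (h₂ 1).2 (h₁ 1) h₂.bijective h₁.bijective.1
  all_goals
    ext f g
    simp

instance {X Z : T} (φ : (X ⟶ Z) →ₗ[k] k) : (serrePairingPerfect φ).IsTriangulated :=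
  have : (serrePairingPerfect φ).IsTriangulatedClosed₃ :=
    .mk' fun Δ hΔ h₁ h₂ n => serrePairing_bijective_of_distTriang φ
      (Triangle.shift_distinguished Δ hΔ n)
      ((serrePairingPerfect φ).le_shift n _ h₁) ((serrePairingPerfect φ).le_shift n _ h₂)
  { exists_zero := by
      refine ⟨0, isZero_zero T, fun n => ?_⟩
      have h0 : IsZero ((0 : T)⟦n⟧) := (shiftFunctor T n).map_isZero (isZero_zero T)
      refine ⟨fun f g _ => h0.eq_of_src _ _, fun f => ⟨0, ?_⟩⟩
      ext g
      rw [h0.eq_of_tgt g 0]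
      simp
    toIsTriangulatedClosed₂ := .of_isTriangulatedClosed₃ }

end Triangulated

end SerreDual
end

noncomputable section

set_option linter.unusedSectionVars false

open Limits Pretriangulated ZeroObject

/-! ### Complexes of projectives in the derived category -/

section Derived

variable {C : Type u} [Category.{v} C] [Abelian C] [HasDerivedCategory.{w} C]

/-- For a K-projective source, morphisms in the derived category are homotopy classes of chain maps.
-/
theorem exists_Q_map_eq_of_isKProjective {K L : CochainComplex C ℤ} [K.IsKProjective]
    (f : DerivedCategory.Q.obj K ⟶ DerivedCategory.Q.obj L) :
    ∃ g : K ⟶ L, DerivedCategory.Q.map g = f := by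
  obtain ⟨g, hg⟩ := (CochainComplex.IsKProjective.Qh_map_bijective K
    ((HomotopyCategory.quotient _ _).obj L)).2
    ((DerivedCategory.quotientCompQhIso C).hom.app K ≫ f ≫
      (DerivedCategory.quotientCompQhIso C).inv.app L)
  obtain ⟨g, rfl⟩ := (HomotopyCategory.quotient _ _).map_surjective g
  refine ⟨g, ?_⟩
  rw [← cancel_epi ((DerivedCategory.quotientCompQhIso C).hom.app K),
    ← DerivedCategory.quotientCompQhIso_hom_naturality, hg]
  simp

theorem nonempty_homotopy_zero_of_Q_map_eq_zero {K L : CochainComplex C ℤ} [K.IsKProjective]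
    (f : K ⟶ L) (hf : DerivedCategory.Q.map f = 0) : Nonempty (Homotopy f 0) := by
  refine ⟨HomotopyCategory.homotopyOfEq _ _ ?_⟩
  apply (CochainComplex.IsKProjective.Qh_map_bijective K
    ((HomotopyCategory.quotient _ _).obj L)).1
  rw [← cancel_mono ((DerivedCategory.quotientCompQhIso C).hom.app L),
    DerivedCategory.quotientCompQhIso_hom_naturality, hf]
  simp

/-- Dévissage of bounded complexes: a triangulated subcategory of the derived category that
contains the objects of a class closed under quotients contains the bounded complexes with terms
in this class. -/
theorem Q_obj_mem_of_bounded (R : ObjectProperty (DerivedCategory C)) [R.IsTriangulated]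
    [R.IsClosedUnderIsomorphisms] (F : ObjectProperty C)
    (hF : ∀ ⦃X Y : C⦄ (f : X ⟶ Y) [Epi f], F X → F Y)
    (hR : ∀ X, F X → R ((DerivedCategory.singleFunctor C 0).obj X)) (n : ℕ) :
    ∀ (a b : ℤ) (_ : b - a < n) (K : CochainComplex C ℤ)
    (_ : ∀ i, i < a ∨ b < i → IsZero (K.X i)) (_ : ∀ i, F (K.X i)),
    R (DerivedCategory.Q.obj K) := by
  induction n with
  | zero =>
    intro a b hab K hK _
    have : IsZero K := by
      rw [IsZero.iff_id_eq_zero]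
      ext i
      exact (hK i (by push_cast at hab; lia)).eq_of_src _ _
    exact R.prop_of_isZero (DerivedCategory.Q.map_isZero this)
  | succ n ih =>
    intro a b hab K hK hKF
    -- Since `b` is the top degree, `K.X b` is a subcomplex. The quotient lives in degrees from `a`
    -- to `b - 1`, and its terms are quotients of those of `K`, which is why closure of `F` under
    -- quotients suffices.
    let ι : (HomologicalComplex.single C (ComplexShape.up ℤ) b).obj (K.X b) ⟶ K :=
      HomologicalComplex.mkHomFromSingle (𝟙 _) (fun j hj =>
        (hK j (by simp at hj; lia)).eq_of_tgt _ _)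
    have hι (i : ℤ) : i = b ∨ IsZero (((HomologicalComplex.single C
        (ComplexShape.up ℤ) b).obj (K.X b)).X i) := by
      by_cases hi : i = b
      · exact Or.inl hi
      · exact Or.inr (HomologicalComplex.isZero_single_obj_X _ _ _ _ hi)
    have hιb : IsIso (ι.f b) := by
      dsimp only [ι]
      rw [HomologicalComplex.mkHomFromSingle_f]
      infer_instance
    have hmono (i : ℤ) : Mono (ι.f i) := by
      rcases hι i with rfl | hi
      · infer_instance
      · exact ⟨fun _ _ _ => hi.eq_of_tgt _ _⟩
    have : Mono ι := HomologicalComplex.mono_of_mono_f _ hmono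
    let S : ShortComplex (CochainComplex C ℤ) :=
      ShortComplex.mk ι (cokernel.π ι) (cokernel.condition ι)
    have hS : S.ShortExact :=
      { exact := ShortComplex.exact_cokernel ι
        mono_f := inferInstanceAs (Mono ι)
        epi_g := inferInstanceAs (Epi (cokernel.π ι)) }
    have hepi (i : ℤ) : Epi ((cokernel.π ι).f i) := inferInstance
    have h₁ : R (DerivedCategory.Q.obj S.X₁) := by
      have h := R.le_shift (-b) _ (hR _ (hKF b))
      exact R.prop_of_iso (((DerivedCategory.singleFunctors C).shiftIso (-b) b 0
        (by lia)).app (K.X b)) h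
    have h₃ : R (DerivedCategory.Q.obj S.X₃) := by
      refine ih a (b - 1) (by push_cast at hab; lia) _ (fun i hi => ?_)
        (fun i => hF ((cokernel.π ι).f i) (hKF i))
      by_cases hib : i = b
      · subst hib
        have hz : (cokernel.π ι).f i = 0 := by
          rw [← cancel_epi (ι.f i), ← HomologicalComplex.comp_f, cokernel.condition]
          simp
        rw [IsZero.iff_id_eq_zero, ← cancel_epi ((cokernel.π ι).f i)]
        rw [hz]
        simp
      · have hz : (cokernel.π ι).f i = 0 := (hK i (by lia)).eq_of_src _ _
        rw [IsZero.iff_id_eq_zero, ← cancel_epi ((cokernel.π ι).f i)]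
        rw [hz]
        simp
    exact R.ext_of_isTriangulatedClosed₂ _ (DerivedCategory.triangleOfSES_distinguished hS) h₁ h₃

end Derived

/-! ### The triangulated category of perfect complexes -/

section Perfect

variable {A : Type v} [Ring A] [HasDerivedCategory.{u'} (ModuleCat.{v} Aᵐᵒᵖ)]

instance : (isPerfect A).IsClosedUnderIsomorphisms where
  of_iso := by
    rintro X Y e ⟨K, hK, hK', ⟨e'⟩⟩
    exact ⟨K, hK, hK', ⟨e.symm ≪≫ e'⟩⟩

instance : (isPerfect A).IsStableUnderShift ℤ where
  isStableUnderShiftBy n :=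
    { le_shift := by
        rintro X ⟨K, ⟨a, b, hK⟩, hK', ⟨e⟩⟩
        refine ⟨K⟦n⟧, ⟨a - n, b - n, fun i hi => hK (i + n) (by lia)⟩, fun i => hK' (i + n),
          ⟨(shiftFunctor _ n).mapIso e ≪≫ (DerivedCategory.Q.commShiftIso n).symm.app K⟩⟩ }

theorem isKProjective_of_bounded_projective {R : Type v} [Ring R]
    (K : CochainComplex (ModuleCat.{v} R) ℤ)
    (b : ℤ) (hb : ∀ i, b < i → IsZero (K.X i)) (h : ∀ i, Module.Projective R (K.X i)) :
    K.IsKProjective := by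
  have : K.IsStrictlyLE b := (K.isStrictlyLE_iff b).2 hb
  have (i : ℤ) : Projective (K.X i) := (IsProjective.iff_projective (K.X i)).1 (h i)
  exact K.isKProjective_of_projective b

/-- Bounded complexes of projectives are K-projective, so the first map lifts to a chain map. The
third vertex is then its mapping cone, whose terms are `K.X (i + 1) × L.X i`. -/
theorem isPerfect_of_distTriang {Δ : Triangle (DerivedCategory (ModuleCat.{v} Aᵐᵒᵖ))}
    (hΔ : Δ ∈ distTriang _) (h₁ : isPerfect A Δ.obj₁) (h₂ : isPerfect A Δ.obj₂) :
    isPerfect A Δ.obj₃ := by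
  obtain ⟨K, ⟨a, b, hK⟩, hK', ⟨e⟩⟩ := h₁
  obtain ⟨L, ⟨a', b', hL⟩, hL', ⟨e'⟩⟩ := h₂
  have := isKProjective_of_bounded_projective K b (fun i hi => hK i (Or.inr hi))
    (fun i => (hK' i).2)
  obtain ⟨g, hg⟩ := exists_Q_map_eq_of_isKProjective (e.inv ≫ Δ.mor₁ ≫ e'.hom)
  have iso := isoTriangleOfIso₁₂ _ _ hΔ (DerivedCategory.mappingCone_triangle_distinguished g)
    e e' (by
      change _ = e.hom ≫ DerivedCategory.Q.map g
      rw [hg]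
      exact (e.hom_inv_id_assoc _).symm)
  let E (i : ℤ) : (CochainComplex.mappingCone g).X i ≅
      ModuleCat.of Aᵐᵒᵖ (K.X (i + 1) × L.X i) :=
    HomologicalComplex.homotopyCofiber.XIsoBiprod g i (i + 1) rfl ≪≫
      ModuleCat.biprodIsoProd _ _
  refine ⟨CochainComplex.mappingCone g, ⟨min (a - 1) a', max b b', fun i hi => ?_⟩, fun i => ?_,
    ⟨Triangle.π₃.mapIso iso⟩⟩
  · refine IsZero.of_iso ?_ (HomologicalComplex.homotopyCofiber.XIsoBiprod g i (i + 1) rfl)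
    rw [biprod_isZero_iff]
    exact ⟨hK _ (by lia), hL _ (by lia)⟩
  · have := (hK' (i + 1)).1
    have := (hK' (i + 1)).2
    have := (hL' i).1
    have := (hL' i).2
    exact ⟨Module.Finite.equiv (E i).symm.toLinearEquiv,
      Module.Projective.of_equiv (E i).symm.toLinearEquiv⟩

theorem isPerfect_single (P : Type v) [AddCommGroup P] [Module Aᵐᵒᵖ P] [Module.Finite Aᵐᵒᵖ P]
    [Module.Projective Aᵐᵒᵖ P] :
    isPerfect A ((DerivedCategory.singleFunctor _ 0).obj (ModuleCat.of Aᵐᵒᵖ P)) := by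
  refine ⟨(HomologicalComplex.single _ (ComplexShape.up ℤ) 0).obj (ModuleCat.of Aᵐᵒᵖ P),
    ⟨0, 0, fun i hi => HomologicalComplex.isZero_single_obj_X _ _ _ _ (by lia)⟩, fun i => ?_,
    ⟨Iso.refl _⟩⟩
  by_cases hi : i = 0
  · subst hi
    let e := (HomologicalComplex.singleObjXSelf (ComplexShape.up ℤ) 0
      (ModuleCat.of Aᵐᵒᵖ P)).symm.toLinearEquiv
    exact ⟨Module.Finite.equiv e, Module.Projective.of_equiv e⟩
  · have hz : IsZero (((HomologicalComplex.single _ (ComplexShape.up ℤ) 0).obj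
      (ModuleCat.of Aᵐᵒᵖ P)).X i) := HomologicalComplex.isZero_single_obj_X _ _ _ _ hi
    have := ModuleCat.subsingleton_of_isZero hz
    exact ⟨inferInstance, inferInstance⟩

instance : (isPerfect A).IsTriangulated :=
  have : (isPerfect A).IsTriangulatedClosed₃ :=
    .mk' fun _ hΔ h₁ h₂ => isPerfect_of_distTriang hΔ h₁ h₂
  { exists_zero := ⟨_, (DerivedCategory.singleFunctor _ 0).map_isZero
      (ModuleCat.isZero_of_subsingleton (ModuleCat.of Aᵐᵒᵖ PUnit)), isPerfect_single PUnit⟩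
    toIsTriangulatedClosed₂ := .of_isTriangulatedClosed₃ }

/-- A triangulated subcategory of the derived category that contains all finitely generated
modules contains all perfect complexes. -/
theorem isPerfect_le_of_finite (R : ObjectProperty (DerivedCategory (ModuleCat.{v} Aᵐᵒᵖ)))
    [R.IsTriangulated] [R.IsClosedUnderIsomorphisms]
    (hR : ∀ M : ModuleCat.{v} Aᵐᵒᵖ, Module.Finite Aᵐᵒᵖ M →
      R ((DerivedCategory.singleFunctor _ 0).obj M)) : isPerfect A ≤ R := by
  rintro X ⟨K, ⟨a, b, hK⟩, hK', ⟨e⟩⟩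
  refine R.prop_of_iso e.symm (Q_obj_mem_of_bounded R (fun M => Module.Finite Aᵐᵒᵖ M)
    (fun X Y f _ hX => Module.Finite.of_surjective f.hom ((ModuleCat.epi_iff_surjective f).1
      inferInstance)) hR (b - a + 1).toNat a b (by lia) K hK fun i => (hK' i).1)

end Perfect
end

noncomputable section

set_option linter.unusedSectionVars false

open Limits Pretriangulated ZeroObject MulOpposite

/-! ### Modules over directed algebras -/

/-- A complete family of orthogonal idempotents `e i` of a `k`-algebra is directed if
`e i A e j = 0` for `i < j` and `e i A e i = k e i`. -/
structure IsDirectedFamily (k : Type u) [Field k] {A : Type v} [Ring A] [Algebra k A] {V : Type w}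
    [Fintype V] [LinearOrder V] (e : V → A) : Prop extends CompleteOrthogonalIdempotents e where
  eq_zero_of_lt : ∀ (i j : V) (x : A), i < j → e i * x * e j = 0
  exists_smul : ∀ (i : V) (x : A), ∃ c : k, e i * x * e i = c • e i

section RightIdeal

variable {A : Type v} [Ring A]

/-- The right ideal `e A` for an idempotent `e`. -/
def idempotentIdeal (e : A) : Submodule Aᵐᵒᵖ A where
  carrier := {a | e * a = a}
  add_mem' := by
    intro a b ha hb
    rw [Set.mem_ofPred_eq, mul_add, ha, hb]
  zero_mem' := mul_zero e
  smul_mem' := by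
    intro c a ha
    rw [Set.mem_ofPred_eq, ← op_unop c, op_smul_eq_mul, ← mul_assoc, ha]

theorem mem_idempotentIdeal {e a : A} : a ∈ idempotentIdeal e ↔ e * a = a := Iff.rfl

variable (A) in
/-- The regular right module is the regular left module of the opposite ring. -/
def opRegularEquiv : Aᵐᵒᵖ ≃ₗ[Aᵐᵒᵖ] A :=
  { (opAddEquiv (α := A)).symm with
    map_smul' := fun _ _ => rfl }

/-- The projection of `A` to `e A`. -/
def toIdempotentIdeal {e : A} (he : IsIdempotentElem e) : A →ₗ[Aᵐᵒᵖ] idempotentIdeal e where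
  toFun a := ⟨e * a, by rw [mem_idempotentIdeal, ← mul_assoc, he.eq]⟩
  map_add' a b := Subtype.ext (mul_add e a b)
  map_smul' c a := Subtype.ext (mul_assoc e a c.unop).symm

theorem toIdempotentIdeal_comp_subtype {e : A} (he : IsIdempotentElem e) :
    (toIdempotentIdeal he).comp (idempotentIdeal e).subtype = LinearMap.id := by
  ext a
  exact a.2

instance : Module.Finite Aᵐᵒᵖ A := Module.Finite.equiv (opRegularEquiv A)

instance : Module.Projective Aᵐᵒᵖ A := Module.Projective.of_equiv (opRegularEquiv A)

theorem finite_idempotentIdeal {e : A} (he : IsIdempotentElem e) :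
    Module.Finite Aᵐᵒᵖ (idempotentIdeal e) :=
  Module.Finite.of_surjective (toIdempotentIdeal he)
    (LinearMap.surjective_of_comp_eq_id _ _ (toIdempotentIdeal_comp_subtype he))

theorem projective_idempotentIdeal {e : A} (he : IsIdempotentElem e) :
    Module.Projective Aᵐᵒᵖ (idempotentIdeal e) :=
  Module.Projective.of_split _ _ (toIdempotentIdeal_comp_subtype he)

/-- The right module `e A` as an object of the category of modules. -/
def idempotentModule (e : A) : ModuleCat.{v} Aᵐᵒᵖ := ModuleCat.of Aᵐᵒᵖ (idempotentIdeal e)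

theorem projective_idempotentModule {e : A} (he : IsIdempotentElem e) :
    Projective (idempotentModule e) :=
  (IsProjective.iff_projective _).1 (projective_idempotentIdeal he)

end RightIdeal

/-! ### Building finitely generated modules from the projectives `e_i A`. -/

section Generation

variable {k : Type u} [Field k] {A : Type v} [Ring A] [Algebra k A] {V : Type w}
    [Fintype V] [LinearOrder V] {e : V → A} (he : IsDirectedFamily k e)

include he

theorem IsDirectedFamily.sum_smul {M : Type*} [AddCommGroup M] [Module Aᵐᵒᵖ M] (m : M) :
    ∑ i, op (e i) • m = m := by
  rw [← Finset.sum_smul, ← Finset.op_sum, he.complete, op_one, one_smul]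

theorem IsDirectedFamily.op_smul_smul_eq_zero_of_lt {M : Type*} [AddCommGroup M] [Module Aᵐᵒᵖ M]
    {i j : V} (hij : i < j) (a : A) (m : M) : op (e j) • op a • op (e i) • m = 0 := by
  rw [smul_smul, smul_smul, ← op_mul, ← op_mul, ← mul_assoc, he.eq_zero_of_lt i j a hij, MulOpposite.op_zero, zero_smul]

/-- On a simple module, one of the idempotents is the identity. -/
theorem IsDirectedFamily.exists_smul_eq_of_isSimpleModule {M : Type*} [AddCommGroup M]
    [Module Aᵐᵒᵖ M] [IsSimpleModule Aᵐᵒᵖ M] : ∃ j, ∀ m : M, op (e j) • m = m := by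
  classical
  have := IsSimpleModule.nontrivial Aᵐᵒᵖ M
  obtain ⟨x, hx⟩ := exists_ne (0 : M)
  have hne : (Finset.univ.filter fun j => ∃ m : M, op (e j) • m ≠ 0).Nonempty := by
    by_contra h
    rw [Finset.not_nonempty_iff_eq_empty, Finset.filter_eq_empty_iff] at h
    apply hx
    rw [← he.sum_smul x]
    exact Finset.sum_eq_zero fun i hi => by
      by_contra hc
      exact h hi ⟨x, hc⟩
  -- Take the least `j` with `M e_j ≠ 0`. A nonzero element of `M e_j` generates `M`; it has no
  -- component at `i > j` by directedness, and none at `i < j` by minimality.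
  obtain ⟨j, hj, hmin⟩ := Finset.exists_min_image _ id hne
  rw [Finset.mem_filter] at hj
  obtain ⟨m, hm⟩ := hj.2
  have hkill (i : V) (hi : i < j) (x : M) : op (e i) • x = 0 := by
    by_contra hc
    exact absurd (hmin i (Finset.mem_filter.2 ⟨Finset.mem_univ _, x, hc⟩)) (not_le.2 hi)
  refine ⟨j, fun x => ?_⟩
  obtain ⟨a, rfl⟩ := IsSimpleModule.toSpanSingleton_surjective Aᵐᵒᵖ hm x
  have hz (i : V) (hi : i ≠ j) : op (e i) • a • op (e j) • m = 0 := by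
    rcases lt_or_gt_of_ne hi with h | h
    · exact hkill i h _
    · exact he.op_smul_smul_eq_zero_of_lt h a.unop m
  have hs := he.sum_smul (a • op (e j) • m)
  rw [Finset.sum_eq_single j (fun i _ hi => hz i hi) (by simp)] at hs
  exact hs

variable [HasDerivedCategory.{u'} (ModuleCat.{v} Aᵐᵒᵖ)]
  (R : ObjectProperty (DerivedCategory (ModuleCat.{v} Aᵐᵒᵖ)))
  [R.IsTriangulated] [R.IsClosedUnderIsomorphisms]

omit he in
theorem single_mem_of_submodule {M : Type v} [AddCommGroup M] [Module Aᵐᵒᵖ M]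
    (N : Submodule Aᵐᵒᵖ M)
    (h₁ : R ((DerivedCategory.singleFunctor _ 0).obj (ModuleCat.of Aᵐᵒᵖ N)))
    (h₃ : R ((DerivedCategory.singleFunctor _ 0).obj (ModuleCat.of Aᵐᵒᵖ (M ⧸ N)))) :
    R ((DerivedCategory.singleFunctor _ 0).obj (ModuleCat.of Aᵐᵒᵖ M)) := by
  have hS : (ShortComplex.mk (ModuleCat.ofHom N.subtype) (ModuleCat.ofHom N.mkQ)
      (by ext x; simp)).ShortExact :=
    ModuleCat.shortComplex_shortExact _ (LinearMap.exact_subtype_mkQ N)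
      N.injective_subtype N.mkQ_surjective
  exact R.ext_of_isTriangulatedClosed₂ _ hS.singleTriangle_distinguished h₁ h₃

/-- Induction on the length. A simple quotient belongs to a single vertex, and that vertex must lie
in `U` because all other idempotents act by zero. -/
theorem single_mem_of_support [IsArtinianRing Aᵐᵒᵖ] (U : V → Prop)
    (hU : ∀ i, U i → ∀ (M : Type v) [AddCommGroup M] [Module Aᵐᵒᵖ M] [IsSimpleModule Aᵐᵒᵖ M],
      (∀ m : M, op (e i) • m = m) →
      R ((DerivedCategory.singleFunctor _ 0).obj (ModuleCat.of Aᵐᵒᵖ M)))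
    (M : Type v) [AddCommGroup M] [Module Aᵐᵒᵖ M] [Module.Finite Aᵐᵒᵖ M]
    (hM : ∀ i, ¬ U i → ∀ m : M, op (e i) • m = 0) :
    R ((DerivedCategory.singleFunctor _ 0).obj (ModuleCat.of Aᵐᵒᵖ M)) := by
  have hlen : IsFiniteLength Aᵐᵒᵖ M :=
    isFiniteLength_iff_isNoetherian_isArtinian.2 ⟨inferInstance, inferInstance⟩
  induction hlen with
  | @of_subsingleton M _ _ _ =>
    exact R.prop_of_isZero ((DerivedCategory.singleFunctor _ 0).map_isZero
      (ModuleCat.isZero_of_subsingleton (ModuleCat.of Aᵐᵒᵖ M)))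
  | @of_simple_quotient M _ _ N _ _ ih =>
    refine single_mem_of_submodule R N
      (ih fun i hi m => Subtype.ext (hM i hi m)) ?_
    obtain ⟨j, hj⟩ := he.exists_smul_eq_of_isSimpleModule (M := M ⧸ N)
    by_cases hUj : U j
    · exact hU j hUj _ hj
    · exfalso
      have := IsSimpleModule.nontrivial Aᵐᵒᵖ (M ⧸ N)
      obtain ⟨x, hx⟩ := exists_ne (0 : M ⧸ N)
      obtain ⟨m, rfl⟩ := N.mkQ_surjective x
      apply hx
      rw [← hj (N.mkQ m), ← map_smul, hM j hUj, map_zero]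

variable (hR : ∀ i, R ((DerivedCategory.singleFunctor _ 0).obj
  (idempotentModule (e i))))

include hR

/-- Induction on the vertex: the simple module at `j` is a quotient of `e_j A`, and the kernel is
supported on vertices below `j`. Indeed `e_j A e_i = 0` for `i > j`, while `e_j A e_j = k e_j` meets
the kernel in zero. -/
theorem single_mem_of_isSimpleModule [IsArtinianRing Aᵐᵒᵖ] (j : V) :
    ∀ (M : Type v) [AddCommGroup M] [Module Aᵐᵒᵖ M] [IsSimpleModule Aᵐᵒᵖ M],
      (∀ m : M, op (e j) • m = m) →
      R ((DerivedCategory.singleFunctor _ 0).obj (ModuleCat.of Aᵐᵒᵖ M)) := by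
  induction j using WellFoundedLT.induction with
  | ind j ih =>
  intro M _ _ _ hM
  have := IsSimpleModule.nontrivial Aᵐᵒᵖ M
  obtain ⟨x, hx⟩ := exists_ne (0 : M)
  let f : idempotentIdeal (e j) →ₗ[Aᵐᵒᵖ] M :=
    (LinearMap.toSpanSingleton Aᵐᵒᵖ M x).comp
      ((opRegularEquiv A).symm.toLinearMap.comp (idempotentIdeal (e j)).subtype)
  have hf (a : idempotentIdeal (e j)) : f a = op (a : A) • x := rfl
  have hsurj : Function.Surjective f := by
    intro m
    obtain ⟨a, rfl⟩ := IsSimpleModule.toSpanSingleton_surjective Aᵐᵒᵖ hx m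
    refine ⟨toIdempotentIdeal (he.idem j) a.unop, ?_⟩
    change op (e j * a.unop) • x = a • x
    rw [op_mul, mul_smul, hM, op_unop]
  have hfin := finite_idempotentIdeal (he.idem j)
  have hker : R ((DerivedCategory.singleFunctor _ 0).obj
      (ModuleCat.of Aᵐᵒᵖ (LinearMap.ker f))) := by
    have : Module.Finite Aᵐᵒᵖ (LinearMap.ker f) := inferInstance
    refine single_mem_of_support he R (fun i => i < j) ih _ ?_
    rintro i hi ⟨⟨a, ha⟩, ha'⟩
    apply Subtype.ext
    apply Subtype.ext
    change a * e i = 0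
    rw [mem_idempotentIdeal] at ha
    rcases (not_lt.1 hi).lt_or_eq with h | rfl
    · rw [← ha]
      exact he.eq_zero_of_lt j i a h
    · obtain ⟨c, hc⟩ := he.exists_smul j a
      rw [ha] at hc
      rw [hc]
      have h0 : op (a * e j) • x = 0 := by
        rw [op_mul, mul_smul]
        rw [LinearMap.mem_ker, hf] at ha'
        rw [ha', smul_zero]
      rw [hc] at h0
      by_cases hc0 : c = 0
      · rw [hc0, zero_smul]
      · exfalso
        apply hx
        rw [← hM x]
        -- If `c ≠ 0`, then `e_j` is a multiple of an element that annihilates `x`, although it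
        -- fixes `x`.
        have : op (e j) = op (algebraMap k A c⁻¹) * op (c • e j) := by
          rw [← op_mul, Algebra.smul_def, mul_assoc, ← Algebra.commutes, ← mul_assoc,
            ← map_mul, mul_inv_cancel₀ hc0, map_one, one_mul]
        rw [this, mul_smul, h0, smul_zero]
  have hS := LinearMap.shortExact_shortComplexKer hsurj
  exact R.ext_of_isTriangulatedClosed₃ _ hS.singleTriangle_distinguished hker (hR j)

/-- Over a directed algebra, the projective modules `e i A` generate all finitely generated
modules by shifts and extensions. -/
theorem single_mem_of_finite [IsArtinianRing Aᵐᵒᵖ] (M : ModuleCat.{v} Aᵐᵒᵖ)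
    (hM : Module.Finite Aᵐᵒᵖ M) : R ((DerivedCategory.singleFunctor _ 0).obj M) :=
  single_mem_of_support he R (fun _ => True)
    (fun i _ => single_mem_of_isSimpleModule he R hR i) M (by simp)

theorem isPerfect_le_of_idempotentIdeal [IsArtinianRing Aᵐᵒᵖ] : isPerfect A ≤ R :=
  isPerfect_le_of_finite R (single_mem_of_finite he R hR)

end Generation

/-! ### Perfect modules and the classical generator over a directed algebra. -/

section Perfect

variable {k : Type u} [Field k] {A : Type v} [Ring A] [Algebra k A] {V : Type w}
    [Fintype V] [LinearOrder V] {e : V → A} (he : IsDirectedFamily k e)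
    [HasDerivedCategory.{u'} (ModuleCat.{v} Aᵐᵒᵖ)]

theorem isPerfect_idempotentIdeal {e : A} (he : IsIdempotentElem e) : isPerfect A
    ((DerivedCategory.singleFunctor _ 0).obj (idempotentModule e)) :=
  have := finite_idempotentIdeal he
  have := projective_idempotentIdeal he
  isPerfect_single _

include he in
-- The generation result applied to the triangulated subcategory of perfect complexes itself. It
-- ensures that `e_i A^*` is available as a Serre dual.
theorem isPerfect_single_of_finite [IsArtinianRing Aᵐᵒᵖ] (M : ModuleCat.{v} Aᵐᵒᵖ)
    (hM : Module.Finite Aᵐᵒᵖ M) : isPerfect A ((DerivedCategory.singleFunctor _ 0).obj M) :=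
  single_mem_of_finite he _ (fun i => isPerfect_idempotentIdeal (he.idem i)) M hM

variable (A) in
/-- The free module of rank one as a perfect complex. -/
def regularPerf : Perf A :=
  ⟨(DerivedCategory.singleFunctor _ 0).obj (ModuleCat.of Aᵐᵒᵖ A), isPerfect_single A⟩

include he in
-- Each `e_i A` is a retract of `A`, and the `e_i A` generate.
theorem isClassicalGenerator_regularPerf [IsArtinianRing Aᵐᵒᵖ] :
    IsClassicalGenerator (regularPerf A) := by
  intro X
  refine isPerfect_le_of_idempotentIdeal he
    (ObjectProperty.singleton (regularPerf A).obj).triangEnvelope (fun i => ?_) _ X.property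
  refine ObjectProperty.prop_of_retract _
    (h := Retract.map (⟨ModuleCat.ofHom (idempotentIdeal (e i)).subtype,
      ModuleCat.ofHom (toIdempotentIdeal (he.idem i)), ?_⟩ :
        Retract (idempotentModule (e i)) (ModuleCat.of Aᵐᵒᵖ A))
        (DerivedCategory.singleFunctor _ 0))
    (ObjectProperty.le_triangEnvelope _ _ (ObjectProperty.singleton_iff _ _ |>.2 rfl))
  exact congrArg ModuleCat.ofHom (toIdempotentIdeal_comp_subtype (he.idem i))

end Perfect
end

noncomputable section

set_option linter.unusedSectionVars false

open Limits Pretriangulated ZeroObject MulOpposite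

/-! ### Finiteness of spaces of morphisms -/

section HomFinite

variable {k : Type u} [Field k] {T : Type v} [Category.{w} T] [Preadditive T] [Linear k T]
  [HasZeroObject T] [HasShift T ℤ] [∀ n : ℤ, (shiftFunctor T n).Additive]
  [∀ n : ℤ, (shiftFunctor T n).Linear k] [Pretriangulated T]

theorem finiteDimensional_of_function_exact {M₁ M₂ M₃ : Type*} [AddCommGroup M₁] [Module k M₁]
    [AddCommGroup M₂] [Module k M₂] [AddCommGroup M₃] [Module k M₃] {f : M₁ →ₗ[k] M₂}
    {g : M₂ →ₗ[k] M₃} (h : Function.Exact f g) [FiniteDimensional k M₁] [FiniteDimensional k M₃] :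
    FiniteDimensional k M₂ := by
  have h' : Function.Exact f g.rangeRestrict := by
    intro x
    rw [← h x, ← LinearMap.mem_ker, LinearMap.ker_rangeRestrict, LinearMap.mem_ker]
  exact Module.Finite.of_exact h' g.surjective_rangeRestrict

theorem subsingleton_shift_hom_iff (X Y : T) (n : ℤ) :
    Subsingleton (X⟦n⟧ ⟶ Y) ↔ Subsingleton (X ⟶ Y⟦-n⟧) := by
  let e : (X⟦n⟧ ⟶ Y) ≃ (X ⟶ Y⟦-n⟧) :=
    (shiftEquiv T n).toAdjunction.homEquiv X Y
  exact e.subsingleton_congr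

variable (k) in
/-- The objects `Y` such that all `Hom(X, Y[n])` are finite-dimensional. -/
def homFiniteFrom (X : T) : ObjectProperty T := fun Y =>
  ∀ n : ℤ, FiniteDimensional k (X ⟶ Y⟦n⟧)

variable (k) in
/-- The objects `X` such that all `Hom(X[n], Y)` are finite-dimensional. -/
def homFiniteTo (Y : T) : ObjectProperty T := fun X =>
  ∀ n : ℤ, FiniteDimensional k (X⟦n⟧ ⟶ Y)

instance (X : T) : (homFiniteFrom k X).IsClosedUnderIsomorphisms where
  of_iso e h n :=
    have := h n
    (Linear.homCongr k (Iso.refl X) ((shiftFunctor T n).mapIso e)).finiteDimensional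

instance (Y : T) : (homFiniteTo k Y).IsClosedUnderIsomorphisms where
  of_iso e h n :=
    have := h n
    (Linear.homCongr k ((shiftFunctor T n).mapIso e) (Iso.refl Y)).finiteDimensional

instance (X : T) : (homFiniteFrom k X).IsTriangulated where
  exists_zero := ⟨0, isZero_zero T, fun n => by
    have : Subsingleton (X ⟶ (0 : T)⟦n⟧) :=
      ⟨fun _ _ => ((shiftFunctor T n).map_isZero (isZero_zero T)).eq_of_tgt _ _⟩
    infer_instance⟩
  isStableUnderShiftBy n :=
    { le_shift := fun Y hY m =>
        have := hY (n + m)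
        (Linear.homCongr k (Iso.refl X) ((shiftFunctorAdd T n m).app Y)).finiteDimensional }
  toIsTriangulatedClosed₂ := .mk' fun Δ hΔ h₁ h₃ n =>
    @finiteDimensional_of_function_exact k _ _ _ _ _ _ _ _ _ _ _ _
      (exact_rightComp_mor₂ (k := k) (Triangle.shift_distinguished Δ hΔ n) X) (h₁ n) (h₃ n)

instance (Y : T) : (homFiniteTo k Y).IsTriangulated where
  exists_zero := ⟨0, isZero_zero T, fun n => by
    have : Subsingleton ((0 : T)⟦n⟧ ⟶ Y) :=
      ⟨fun _ _ => ((shiftFunctor T n).map_isZero (isZero_zero T)).eq_of_src _ _⟩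
    infer_instance⟩
  isStableUnderShiftBy n :=
    { le_shift := fun X hX m =>
        have := hX (n + m)
        (Linear.homCongr k ((shiftFunctorAdd T n m).app X) (Iso.refl Y)).finiteDimensional }
  toIsTriangulatedClosed₂ := .mk' fun Δ hΔ h₁ h₃ n =>
    @finiteDimensional_of_function_exact k _ _ _ _ _ _ _ _ _ _ _ _
      (exact_leftComp_mor₁ (k := k) (Triangle.shift_distinguished Δ hΔ n) Y) (h₃ n) (h₁ n)

end HomFinite

/-! ### Vanishing of morphisms out of projectives. -/

section ProjectiveSingle

variable {C : Type u} [Category.{v} C] [Abelian C] [HasDerivedCategory.{w} C]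

/-- There are no morphisms from a projective object to nonzero shifts of an object. -/
theorem subsingleton_hom_single_shift_of_projective (P M : C) [Projective P] (n : ℤ)
    (hn : n ≠ 0) : Subsingleton ((DerivedCategory.singleFunctor C 0).obj P ⟶
      ((DerivedCategory.singleFunctor C 0).obj M)⟦n⟧) := by
  refine subsingleton_of_forall_eq 0 fun f => ?_
  let e := ((DerivedCategory.singleFunctors C).shiftIso n (-n) 0 (by lia)).app M
  suffices f ≫ e.hom = 0 by
    rw [← cancel_mono e.hom, this, zero_comp]
  -- For `n < 0` the target sits in a positive degree and the t-structure gives the vanishing; for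
  -- `n > 0` it sits in a negative degree and projectivity is needed.
  rcases lt_or_gt_of_ne hn with h | h
  · exact DerivedCategory.TStructure.t.zero_of_isLE_of_isGE (f ≫ e.hom) 0 (-n) (by lia)
      (inferInstanceAs (((DerivedCategory.singleFunctor C 0).obj P).IsLE 0))
      (inferInstanceAs (((DerivedCategory.singleFunctor C (-n)).obj M).IsGE (-n)))
  · exact DerivedCategory.from_singleFunctor_obj_eq_zero_of_projective
      (L := (CochainComplex.singleFunctor C (-n)).obj M) (i := 0) (f ≫ e.hom) (-n) (by lia)

end ProjectiveSingle

/-! ### Existence of Serre functors -/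

section ModuleLinear

variable {k : Type u} [Field k] {A : Type v} [Ring A] [Algebra k A]

/-- The homomorphism of right modules from `e A` determined by the image of `e`. -/
def idempotentIdealHom (e : A) {M : Type*} [AddCommGroup M] [Module Aᵐᵒᵖ M] (m : M) :
    idempotentIdeal e →ₗ[Aᵐᵒᵖ] M :=
  ((LinearMap.toSpanSingleton Aᵐᵒᵖ M m).comp (opRegularEquiv A).symm.toLinearMap).comp
    (idempotentIdeal e).subtype

/-- The element `e` of `e A`. -/
def idempotentIdealGen {e : A} (he : IsIdempotentElem e) : idempotentIdeal e := ⟨e, he⟩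

/-- A homomorphism from `e A` is determined by the image of `e`. -/
theorem map_idempotentIdeal_eq {e : A} (he : IsIdempotentElem e) {M : Type*} [AddCommGroup M]
    [Module Aᵐᵒᵖ M] (f : idempotentIdeal e →ₗ[Aᵐᵒᵖ] M) (a : idempotentIdeal e) :
    f a = op (a : A) • f (idempotentIdealGen he) := by
  rw [← map_smul]
  congr 1
  exact Subtype.ext a.2.symm

/-- The element of `e' A` determined by a homomorphism `e A → e' A`. -/
def idempotentModuleElt {e e' : A} (he : IsIdempotentElem e)
    (f : idempotentModule e ⟶ idempotentModule e') : idempotentIdeal e' :=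
  (f.hom : idempotentIdeal e →ₗ[Aᵐᵒᵖ] idempotentIdeal e') (idempotentIdealGen he)

/-- The homomorphism `e A → e' A` given by left multiplication by `e' y e`. -/
def idempotentModuleHom (e : A) {e' : A} (he' : IsIdempotentElem e') (y : A) :
    idempotentModule e ⟶ idempotentModule e' :=
  ModuleCat.ofHom (idempotentIdealHom e (toIdempotentIdeal he' (y * e)))

theorem idempotentModuleElt_injective {e e' : A} (he : IsIdempotentElem e) :
    Function.Injective fun f : idempotentModule e ⟶ idempotentModule e' =>
      (idempotentModuleElt he f : A) := by
  intro f g hfg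
  replace hfg : idempotentModuleElt he f = idempotentModuleElt he g := Subtype.ext hfg
  apply ModuleCat.hom_ext
  refine LinearMap.ext fun a : idempotentIdeal e => ?_
  exact (map_idempotentIdeal_eq he
    (f.hom : idempotentIdeal e →ₗ[Aᵐᵒᵖ] idempotentIdeal e') a).trans
    ((congrArg (op (a : A) • ·) hfg).trans (map_idempotentIdeal_eq he
      (g.hom : idempotentIdeal e →ₗ[Aᵐᵒᵖ] idempotentIdeal e') a).symm)

theorem idempotentModuleElt_hom {e e' : A} (he : IsIdempotentElem e) (he' : IsIdempotentElem e')
    (y : A) : (idempotentModuleElt he (idempotentModuleHom e he' y) : A) = e' * (y * e) := by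
  change e' * (y * e) * e = e' * (y * e)
  rw [mul_assoc, mul_assoc, he.eq]

theorem idempotentModuleElt_smul {e e' : A} (he : IsIdempotentElem e) (c : k)
    (f : idempotentModule e ⟶ idempotentModule e') :
    (idempotentModuleElt he (c • f) : A) = c • (idempotentModuleElt he f : A) := by
  change (idempotentModuleElt he f : A) * algebraMap k A c = _
  rw [← Algebra.commutes, ← Algebra.smul_def]

theorem finiteDimensional_hom_idempotentModule [FiniteDimensional k A] {e e' : A}
    (he : IsIdempotentElem e) :
    FiniteDimensional k (idempotentModule e ⟶ idempotentModule e') :=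
  let L : (idempotentModule e ⟶ idempotentModule e') →ₗ[k] A :=
    { toFun := fun f => idempotentModuleElt he f
      map_add' := fun _ _ => rfl
      map_smul' := fun c f => idempotentModuleElt_smul he c f }
  FiniteDimensional.of_injective L (idempotentModuleElt_injective he)

instance : IsScalarTower k Aᵐᵒᵖ (SerreBimodule k A) where
  smul_assoc c a f := DFunLike.ext _ _ fun x => by
    change f ((c • a.unop) * x) = c • f (a.unop * x)
    rw [smul_mul_assoc]
    exact LinearMap.map_smul (f : A →ₗ[k] k) c _

instance [FiniteDimensional k A] : FiniteDimensional k (SerreBimodule k A) :=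
  inferInstanceAs (FiniteDimensional k (A →ₗ[k] k))

theorem finite_serreBimodule [FiniteDimensional k A] : Module.Finite Aᵐᵒᵖ (SerreBimodule k A) :=
  Module.Finite.of_restrictScalars_finite k _ _

variable (k A) in
theorem isArtinianRing_op [FiniteDimensional k A] : IsArtinianRing Aᵐᵒᵖ :=
  have : FiniteDimensional k Aᵐᵒᵖ := (opLinearEquiv k (M := A)).finiteDimensional
  IsArtinianRing.of_finite k Aᵐᵒᵖ

variable (k) in
/-- The right module `e A^*`, the dual of the left ideal `A e`. -/
def serreIdeal (e : A) : Submodule Aᵐᵒᵖ (SerreBimodule k A) where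
  carrier := {f | ∀ x, f (x * e) = f x}
  add_mem' := by
    intro f g hf hg x
    change f (x * e) + g (x * e) = f x + g x
    rw [hf, hg]
  zero_mem' := fun _ => rfl
  smul_mem' := by
    intro c f hf x
    change f (c.unop * (x * e)) = f (c.unop * x)
    rw [← mul_assoc, hf]

theorem finite_serreIdeal [FiniteDimensional k A] (e : A) :
    Module.Finite Aᵐᵒᵖ (serreIdeal k e) :=
  have := isArtinianRing_op k A
  have := finite_serreBimodule (k := k) (A := A)
  inferInstance

end ModuleLinear

/-! ### The Serre dual of `e A`. -/

section SerreModule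

variable {k : Type u} [Field k] {A : Type (max u v)} [Ring A] [Algebra k A]

variable (k) in
/-- The right module `e A^*` as an object of the category of modules. -/
def serreModule (e : A) : ModuleCat.{max u v} Aᵐᵒᵖ := ModuleCat.of Aᵐᵒᵖ (serreIdeal k e)

/-- The element of `e' A^*` determined by a homomorphism `e A → e' A^*`. -/
def serreModuleElt {e e' : A} (he : IsIdempotentElem e)
    (f : idempotentModule e ⟶ serreModule.{u, v} k e') : serreIdeal k e' :=
  (f.hom : idempotentIdeal e →ₗ[Aᵐᵒᵖ] serreIdeal k e') (idempotentIdealGen he)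

/-- The canonical functional on `Hom(e A, e A^*)`. -/
def serreFunctional {e : A} (he : IsIdempotentElem e) :
    (idempotentModule e ⟶ serreModule.{u, v} k e) →ₗ[k] k where
  toFun f := (serreModuleElt.{u, v} he f : SerreBimodule k A) 1
  map_add' f g := rfl
  map_smul' c f := by
    change (serreModuleElt.{u, v} he f : SerreBimodule k A) (algebraMap k A c * 1) = _
    rw [← Algebra.smul_def]
    exact LinearMap.map_smul
      ((serreModuleElt.{u, v} he f : SerreBimodule k A) : A →ₗ[k] k) c _

theorem serreModuleElt_mul {e e' : A} (he' : IsIdempotentElem e')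
    (g : idempotentModule e' ⟶ serreModule.{u, v} k e) (x : A) :
    (serreModuleElt.{u, v} he' g : SerreBimodule k A) (e' * x) =
      (serreModuleElt.{u, v} he' g : SerreBimodule k A) x :=
  DFunLike.congr_fun (congrArg Subtype.val (map_idempotentIdeal_eq he'
    (g.hom : idempotentIdeal e' →ₗ[Aᵐᵒᵖ] serreIdeal k e) (idempotentIdealGen he')).symm) x

theorem serreFunctional_comp {e e' : A} (he : IsIdempotentElem e) (he' : IsIdempotentElem e')
    (u : idempotentModule e ⟶ idempotentModule e')
    (g : idempotentModule e' ⟶ serreModule.{u, v} k e) :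
    serreFunctional.{u, v} he (u ≫ g) =
      (serreModuleElt.{u, v} he' g : SerreBimodule k A) (idempotentModuleElt he u) := by
  have h := map_idempotentIdeal_eq he' (g.hom : idempotentIdeal e' →ₗ[Aᵐᵒᵖ] serreIdeal k e)
    (idempotentModuleElt he u)
  have h' : serreFunctional.{u, v} he (u ≫ g) =
      (serreModuleElt.{u, v} he' g : SerreBimodule k A) ((idempotentModuleElt he u : A) * 1) :=
    DFunLike.congr_fun (congrArg Subtype.val h) 1
  rw [h', mul_one]

/-- Evaluation at the idempotents identifies `Hom(e A, e' A)` with `e' A e` and `Hom(e' A, e A^*)`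
with the functionals on `e' A e`; the pairing becomes evaluation. -/
theorem serrePairing_serreFunctional_bijective {e e' : A} (he : IsIdempotentElem e)
    (he' : IsIdempotentElem e') : Function.Bijective
      (serrePairing (serreFunctional.{u, v} (k := k) he) (idempotentModule e')) := by
  constructor
  · rw [injective_iff_map_eq_zero]
    intro g hg
    have h0 : serreModuleElt.{u, v} he' g = 0 := by
      apply Subtype.ext
      refine DFunLike.ext _ _ fun y => ?_
      have h1 := LinearMap.congr_fun hg (idempotentModuleHom e he' y)
      rw [serrePairing_apply, serreFunctional_comp he he', idempotentModuleElt_hom,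
        serreModuleElt_mul, (serreModuleElt.{u, v} he' g).2] at h1
      exact h1
    apply ModuleCat.hom_ext
    refine LinearMap.ext fun a : idempotentIdeal e' => ?_
    exact (map_idempotentIdeal_eq he'
      (g.hom : idempotentIdeal e' →ₗ[Aᵐᵒᵖ] serreIdeal k e) a).trans
      ((congrArg (op (a : A) • ·) h0).trans
        (smul_zero (A := serreIdeal k e) (op (a : A))))
  · intro φ
    -- The functional `φ` on `e' A e`, extended to `A` along `y ↦ e' y e`.
    let F : A →ₗ[k] k :=
      { toFun := fun y => φ (idempotentModuleHom e he' y)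
        map_add' := fun y z => by
          rw [← map_add]
          congr 1
          apply idempotentModuleElt_injective he
          change _ = (idempotentModuleElt he (idempotentModuleHom e he' y) : A) +
            (idempotentModuleElt he (idempotentModuleHom e he' z) : A)
          simp only [idempotentModuleElt_hom, add_mul, mul_add]
        map_smul' := fun c y => by
          rw [RingHom.id_apply, ← map_smul]
          congr 1
          apply idempotentModuleElt_injective he
          change _ = (idempotentModuleElt he (c • idempotentModuleHom e he' y) : A)
          simp only [idempotentModuleElt_hom, idempotentModuleElt_smul, smul_mul_assoc,
            mul_smul_comm] }
    have hF (y : A) : F y = φ (idempotentModuleHom e he' y) := rfl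
    have hFe (x : A) : F (x * e) = F x := by
      rw [hF, hF]
      congr 1
      apply idempotentModuleElt_injective he
      simp only [idempotentModuleElt_hom, mul_assoc, he.eq]
    let F' : serreIdeal k e := ⟨F, hFe⟩
    let g : idempotentModule e' ⟶ serreModule.{u, v} k e :=
      ModuleCat.ofHom (idempotentIdealHom e' F')
    refine ⟨g, ?_⟩
    ext u
    rw [serrePairing_apply, serreFunctional_comp he he']
    change F (e' * (idempotentModuleElt he u : A)) = φ u
    rw [hF]
    congr 1
    apply idempotentModuleElt_injective he
    dsimp only
    have h1 := (idempotentModuleElt he u).2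
    rw [mem_idempotentIdeal] at h1
    have h2 : (idempotentModuleElt he u : A) * e = (idempotentModuleElt he u : A) :=
      congrArg Subtype.val (map_idempotentIdeal_eq he
        (u.hom : idempotentIdeal e →ₗ[Aᵐᵒᵖ] idempotentIdeal e') (idempotentIdealGen he)).symm
    rw [idempotentModuleElt_hom, h1, h2, h1]

variable {V : Type w} [Fintype V] [LinearOrder V] {e : V → A} (he : IsDirectedFamily k e)
  [FiniteDimensional k A] [HasDerivedCategory.{u'} (ModuleCat.{max u v} Aᵐᵒᵖ)]

include he

/-- Dévissage in each variable reduces to maps between the `e_i A`: these form subspaces of `A` in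
degree zero and vanish in the other degrees. -/
theorem finiteDimensional_hom_of_isPerfect {X Y : DerivedCategory (ModuleCat.{max u v} Aᵐᵒᵖ)}
    (hX : isPerfect A X) (hY : isPerfect A Y) : FiniteDimensional k (X ⟶ Y) := by
  have := isArtinianRing_op k A
  have h (j : V) : isPerfect A ≤ homFiniteFrom k ((DerivedCategory.singleFunctor _ 0).obj
      (idempotentModule (e j))) := by
    refine isPerfect_le_of_idempotentIdeal he _ fun i n => ?_
    by_cases hn : n = 0
    · subst hn
      have := finiteDimensional_hom_idempotentModule (k := k) (e' := e i) (he.idem j)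
      exact ((homLinearEquivOfFullyFaithful k (DerivedCategory.singleFunctor _ 0) _ _).trans
        (Linear.homCongr k (Iso.refl _) ((shiftFunctorZero _ ℤ).symm.app _))).finiteDimensional
    · have := projective_idempotentModule (he.idem j)
      have := subsingleton_hom_single_shift_of_projective
        (idempotentModule (e j)) (idempotentModule (e i))
        n hn
      infer_instance
  have h' : isPerfect A ≤ homFiniteTo k Y := by
    refine isPerfect_le_of_idempotentIdeal he _ fun i n => ?_
    have := h i Y hY (-n)
    exact ((homLinearEquivOfFullyFaithful k (shiftFunctor _ n)
      ((DerivedCategory.singleFunctor _ 0).obj (idempotentModule (e i))) (Y⟦-n⟧)).trans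
      (Linear.homCongr k (Iso.refl _) ((shiftEquiv _ n).counitIso.app Y))).finiteDimensional
  have := h' X hX 0
  exact (Linear.homCongr k ((shiftFunctorZero _ ℤ).app X) (Iso.refl Y)).finiteDimensional

/-- The dual object is `e_i A^*`. Dévissage in `Y` leaves the shifts of `e_j A`: for the zero shift
this is the module computation, and for the others both sides of the pairing vanish by projectivity.
-/
theorem hasSerreDual_idempotentIdeal (i : V) : HasSerreDual k (isPerfect A)
    ((DerivedCategory.singleFunctor _ 0).obj
      (idempotentModule (e i))) := by
  have := isArtinianRing_op k A
  refine ⟨(DerivedCategory.singleFunctor _ 0).obj (serreModule.{u, v} k (e i)),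
    mapFunctional (DerivedCategory.singleFunctor _ 0) (serreFunctional.{u, v} (he.idem i)),
    isPerfect_single_of_finite he _ (finite_serreIdeal (e i)),
    fun Y hY => ?_⟩
  refine serrePairingPerfect.bijective (isPerfect_le_of_idempotentIdeal he _ (fun j n => ?_) Y hY)
  by_cases hn : n = 0
  · subst hn
    exact serrePairing_bijective_of_iso _ ((shiftFunctorZero _ ℤ).symm.app _)
      (serrePairing_mapFunctional_bijective _ _
        (serrePairing_serreFunctional_bijective (he.idem i) (he.idem j)))
  · have := projective_idempotentModule (he.idem i)
    have := projective_idempotentModule (he.idem j)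
    have h₁ := subsingleton_hom_single_shift_of_projective
      (idempotentModule (e i)) (idempotentModule (e j)) n hn
    have h₂ := (subsingleton_shift_hom_iff _ _ n).2 (subsingleton_hom_single_shift_of_projective
      (idempotentModule (e j)) (serreModule.{u, v} k (e i))
      (-n) (neg_ne_zero.2 hn))
    refine ⟨fun f g _ => Subsingleton.elim _ _, fun f => ⟨0, ?_⟩⟩
    ext g
    rw [Subsingleton.elim g 0]
    simp

/-- The perfect complexes over a finite-dimensional directed algebra have a Serre functor. -/
theorem nonempty_serreFunctor_perf : Nonempty (SerreFunctor k (Perf A)) := by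
  have := isArtinianRing_op k A
  exact nonempty_serreFunctor (isPerfect A)
    (fun X hX => isPerfect_le_of_idempotentIdeal he (HasSerreDual k (isPerfect A))
      (hasSerreDual_idempotentIdeal he) X hX)
    (fun X Y hX hY => finiteDimensional_hom_of_isPerfect he hX hY)

end SerreModule
end

noncomputable section

set_option linter.unusedSectionVars false

open Limits Pretriangulated ZeroObject MulOpposite

/-! ### Regular modules and the canonical t-structure -/

section Regular

variable (k : Type u) [Field k] (A : Type v) [Ring A] [Algebra k A]

/-- The regular right module as an object of the category of modules. -/
def regularModule : ModuleCat.{v} Aᵐᵒᵖ := ModuleCat.of Aᵐᵒᵖ A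

instance : Projective (regularModule A) :=
  (IsProjective.iff_projective _).1 (inferInstanceAs (Module.Projective Aᵐᵒᵖ A))

variable {A}

/-- Homomorphisms from the regular module. -/
def regularModuleHom {M : ModuleCat.{v} Aᵐᵒᵖ} (m : M) : regularModule A ⟶ M :=
  ModuleCat.ofHom ((LinearMap.toSpanSingleton Aᵐᵒᵖ M m).comp (opRegularEquiv A).symm.toLinearMap)

theorem regularModuleHom_one {M : ModuleCat.{v} Aᵐᵒᵖ} (m : M) :
    (regularModuleHom m).hom (1 : A) = m := one_smul Aᵐᵒᵖ m

theorem regularModuleHom_comp {M N : ModuleCat.{v} Aᵐᵒᵖ} (m : M) (f : M ⟶ N) :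
    regularModuleHom m ≫ f = regularModuleHom (f.hom m) := by
  apply ModuleCat.hom_ext
  refine LinearMap.ext fun a : A => ?_
  exact f.hom.map_smul (op a) m

/-- The elements of an algebra are the endomorphisms of its regular module. -/
def regularModuleEnd : A ≃ₗ[k] (regularModule A ⟶ regularModule A) :=
  LinearEquiv.ofBijective
    ({ toFun := fun a : A => regularModuleHom (M := regularModule A) a
       map_add' := fun a b : A => by
         apply ModuleCat.hom_ext
         exact LinearMap.ext fun x : A => add_mul a b x
       map_smul' := fun (c : k) (a : A) => by
         apply ModuleCat.hom_ext
         refine LinearMap.ext fun x : A => ?_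
         change (c • a) * x = (a * x) * algebraMap k A c
         rw [← Algebra.commutes, ← Algebra.smul_def, smul_mul_assoc] } :
      A →ₗ[k] (regularModule A ⟶ regularModule A))
    ⟨fun a b h => by
      have h1 := congrArg (fun f : regularModule A ⟶ regularModule A => f.hom (1 : A)) h
      exact (regularModuleHom_one (M := regularModule A) a).symm.trans
        (h1.trans (regularModuleHom_one (M := regularModule A) b)),
    fun f => ⟨f.hom (1 : A), by
      apply ModuleCat.hom_ext
      refine LinearMap.ext fun x : A => ?_
      refine (f.hom.map_smul (op x) (1 : A)).symm.trans ?_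
      exact congrArg f.hom (one_mul x)⟩⟩

theorem regularModuleEnd_mul (a b : A) :
    regularModuleEnd k (b * a) = regularModuleEnd k a ≫ regularModuleEnd k b := by
  apply ModuleCat.hom_ext
  exact LinearMap.ext fun x : A => mul_assoc b a x

end Regular

/-! ### Detecting cohomological bounds by maps from the regular module. -/

section TStructure

variable {A : Type v} [Ring A] [HasDerivedCategory.{u'} (ModuleCat.{v} Aᵐᵒᵖ)]

/-- The morphism from the regular module in degree `n` given by a cycle of a complex. -/
def cycleHom {K : CochainComplex (ModuleCat.{v} Aᵐᵒᵖ) ℤ} {n : ℤ} (z : K.X n)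
    (hz : (K.d n (n + 1)).hom z = 0) :
    (HomologicalComplex.single _ (ComplexShape.up ℤ) n).obj (regularModule A) ⟶ K :=
  HomologicalComplex.mkHomFromSingle (regularModuleHom z) (by
    rintro j rfl
    rw [regularModuleHom_comp, hz]
    apply ModuleCat.hom_ext
    exact LinearMap.ext fun a : A => smul_zero (op a))

theorem cycleHom_f {K : CochainComplex (ModuleCat.{v} Aᵐᵒᵖ) ℤ} {n : ℤ} (z : K.X n)
    (hz : (K.d n (n + 1)).hom z = 0) :
    (cycleHom z hz).f n = (HomologicalComplex.singleObjXSelf (ComplexShape.up ℤ) n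
      (regularModule A)).hom ≫ regularModuleHom z :=
  HomologicalComplex.mkHomFromSingle_f _ _

theorem isKProjective_single (P : ModuleCat.{v} Aᵐᵒᵖ) [Projective P] (n : ℤ) :
    CochainComplex.IsKProjective
      ((HomologicalComplex.single (ModuleCat.{v} Aᵐᵒᵖ) (ComplexShape.up ℤ) n).obj P) := by
  have (i : ℤ) : Projective (((HomologicalComplex.single _ (ComplexShape.up ℤ) n).obj P).X i) := by
    by_cases hi : i = n
    · subst hi
      exact Projective.of_iso (HomologicalComplex.singleObjXSelf _ i P).symm inferInstance
    · exact Projective.of_iso (HomologicalComplex.isZero_single_obj_X _ _ _ _ hi).isoZero.symm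
        inferInstance
  have : CochainComplex.IsStrictlyLE
      ((HomologicalComplex.single (ModuleCat.{v} Aᵐᵒᵖ) (ComplexShape.up ℤ) n).obj P) n :=
    inferInstanceAs (((CochainComplex.singleFunctor _ n).obj P).IsStrictlyLE n)
  exact CochainComplex.isKProjective_of_projective _ n

/-- The source is K-projective, so the map is null-homotopic; the homotopy evaluated at `1` is a
preimage of the cycle under the differential. -/
theorem exists_d_eq_of_Q_map_cycleHom_eq_zero {K : CochainComplex (ModuleCat.{v} Aᵐᵒᵖ) ℤ} {n : ℤ}
    (z : K.X n) (hz : (K.d n (n + 1)).hom z = 0)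
    (h : DerivedCategory.Q.map (cycleHom z hz) = 0) :
    ∃ y : K.X (n - 1), (K.d (n - 1) n).hom y = z := by
  have := isKProjective_single (regularModule A) n
  obtain ⟨H⟩ := nonempty_homotopy_zero_of_Q_map_eq_zero _ h
  have hc := H.comm n
  rw [dNext_eq H.hom (show (ComplexShape.up ℤ).Rel n (n + 1) from rfl),
    prevD_eq H.hom (show (ComplexShape.up ℤ).Rel (n - 1) n by simp)] at hc
  have hd : ((HomologicalComplex.single _ (ComplexShape.up ℤ) n).obj
      (regularModule A)).d n (n + 1) = 0 := by simp
  rw [hd, zero_comp, zero_add, HomologicalComplex.zero_f, add_zero, cycleHom_f, ← Iso.eq_inv_comp] at hc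
  have hc' := congrArg (fun f : regularModule A ⟶ K.X n => f.hom (1 : A)) hc
  exact ⟨_, hc'.symm.trans (regularModuleHom_one z)⟩

theorem hom_single_eq_zero_of_isLE {X : DerivedCategory (ModuleCat.{v} Aᵐᵒᵖ)} (n i : ℤ)
    (hi : n < i) (hX : X.IsLE n) (f : (DerivedCategory.singleFunctor _ i).obj (regularModule A) ⟶ X) :
    f = 0 := by
  obtain ⟨K, hK, ⟨e⟩⟩ := X.exists_iso_Q_obj_of_isLE n
  rw [← cancel_mono e.hom, zero_comp]
  exact DerivedCategory.from_singleFunctor_obj_eq_zero_of_projective (f ≫ e.hom) n hi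

/-- An object is `≤ n` if there are no morphisms to it from the regular module in higher
degrees. -/
theorem isLE_of_hom_single_eq_zero (X : DerivedCategory (ModuleCat.{v} Aᵐᵒᵖ)) (n : ℤ)
    (hX : ∀ i, n < i → ∀ f : (DerivedCategory.singleFunctor _ i).obj (regularModule A) ⟶ X,
      f = 0) : X.IsLE n := by
  obtain ⟨K, ⟨e⟩⟩ : ∃ K, Nonempty (DerivedCategory.Q.obj K ≅ X) :=
    ⟨_, ⟨DerivedCategory.Q.objObjPreimageIso X⟩⟩
  have hK : K.IsLE n := by
    rw [CochainComplex.isLE_iff]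
    intro i hi
    rw [HomologicalComplex.exactAt_iff' K (i - 1) i (i + 1) (by simp) (by simp),
      ShortComplex.moduleCat_exact_iff]
    intro z hz
    refine exists_d_eq_of_Q_map_cycleHom_eq_zero z hz ?_
    rw [← cancel_mono e.hom, zero_comp]
    exact hX i hi _
  have : (DerivedCategory.Q.obj K).IsLE n := inferInstance
  exact DerivedCategory.TStructure.t.isLE_of_iso e n

/-- A morphism from an object `≤ n` to a module in degree `n` vanishes if it vanishes on all
morphisms from the regular module. -/
theorem eq_zero_of_single_comp_eq_zero {X : DerivedCategory (ModuleCat.{v} Aᵐᵒᵖ)} {n : ℤ}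
    (hX : X.IsLE n) {M : ModuleCat.{v} Aᵐᵒᵖ}
    (g : X ⟶ (DerivedCategory.singleFunctor _ n).obj M)
    (hg : ∀ x : (DerivedCategory.singleFunctor _ n).obj (regularModule A) ⟶ X, x ≫ g = 0) :
    g = 0 := by
  obtain ⟨K, hK, ⟨e⟩⟩ := X.exists_iso_Q_obj_of_isLE n
  have hg' : ∃ g' : DerivedCategory.Q.obj K ⟶
      DerivedCategory.Q.obj ((CochainComplex.singleFunctor _ n).obj M), g = e.hom ≫ g' :=
    ⟨e.inv ≫ g, (e.hom_inv_id_assoc g).symm⟩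
  obtain ⟨g', rfl⟩ := hg'
  -- The roof is chosen with `K'` still concentrated in degrees `≤ n`. Every element of degree `n`
  -- is then a cycle and yields a test map from the regular module.
  obtain ⟨K', hK', s, hs, g', rfl⟩ := DerivedCategory.right_fac_of_isStrictlyLE g' n
  suffices h : g' = 0 by
    have h' : inv (DerivedCategory.Q.map s) ≫ DerivedCategory.Q.map g' = 0 := by
      rw [h, Functor.map_zero, comp_zero]
    exact (congrArg (fun t => e.hom ≫ t) h').trans comp_zero
  apply HomologicalComplex.to_single_hom_ext
  apply ModuleCat.hom_ext
  refine LinearMap.ext fun z => ?_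
  have hz : (K'.d n (n + 1)).hom z = 0 := by
    rw [(K'.isZero_of_isStrictlyLE n (n + 1) (by lia)).eq_of_tgt (K'.d n (n + 1)) 0]
    rfl
  have h0 : DerivedCategory.Q.map (cycleHom z hz ≫ g') = 0 := by
    have h : (DerivedCategory.Q.map (cycleHom z hz ≫ s) ≫ e.inv) ≫ e.hom ≫
        inv (DerivedCategory.Q.map s) ≫ DerivedCategory.Q.map g' = 0 := hg _
    rwa [Category.assoc, e.inv_hom_id_assoc, Functor.map_comp, Category.assoc,
      IsIso.hom_inv_id_assoc, ← Functor.map_comp] at h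
  obtain ⟨φ, hφ⟩ := (CochainComplex.singleFunctor _ n).map_surjective
    (X := regularModule A) (Y := M) (cycleHom z hz ≫ g')
  have hφ0 : φ = 0 := by
    apply (DerivedCategory.singleFunctor _ n).map_injective
    rw [Functor.map_zero]
    exact (congrArg (fun t => DerivedCategory.Q.map t) hφ).trans h0
  have hc : cycleHom z hz ≫ g' = 0 := by
    refine hφ.symm.trans ?_
    rw [hφ0, Functor.map_zero]
    rfl
  have h1 : (cycleHom z hz).f n ≫ g'.f n = 0 :=
    congrArg (fun f => HomologicalComplex.Hom.f f n) hc
  rw [cycleHom_f, Category.assoc] at h1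
  have h2 : regularModuleHom z ≫ g'.f n = 0 := by
    rw [← cancel_epi (HomologicalComplex.singleObjXSelf (ComplexShape.up ℤ) n
      (regularModule A)).hom, h1, comp_zero]
  have h3 := congrArg (fun f => f.hom (1 : A)) h2
  exact (congrArg (g'.f n).hom (regularModuleHom_one z)).symm.trans h3

theorem exists_isLE_of_isPerfect {X : DerivedCategory (ModuleCat.{v} Aᵐᵒᵖ)}
    (hX : isPerfect A X) : ∃ n, X.IsLE n := by
  obtain ⟨K, ⟨a, b, hK⟩, _, ⟨e⟩⟩ := hX
  have : K.IsStrictlyLE b := (K.isStrictlyLE_iff b).2 fun i hi => hK i (Or.inr hi)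
  have : (DerivedCategory.Q.obj K).IsLE b := inferInstance
  exact ⟨b, DerivedCategory.TStructure.t.isLE_of_iso e.symm b⟩

/-- A morphism from a bounded complex of projectives is a chain map, and it has no room to be
nonzero when the target lives strictly below all terms of the source. -/
theorem exists_hom_eq_zero_of_isPerfect {X : DerivedCategory (ModuleCat.{v} Aᵐᵒᵖ)}
    (hX : isPerfect A X) : ∃ a : ℤ, ∀ (Y : DerivedCategory (ModuleCat.{v} Aᵐᵒᵖ)) (n : ℤ),
      n < a → Y.IsLE n → ∀ f : X ⟶ Y, f = 0 := by
  obtain ⟨K, ⟨a, b, hK⟩, hK', ⟨e⟩⟩ := hX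
  refine ⟨a, fun Y n hn hY f => ?_⟩
  have := isKProjective_of_bounded_projective K b (fun i hi => hK i (Or.inr hi))
    (fun i => (hK' i).2)
  obtain ⟨L, hL, ⟨e'⟩⟩ := Y.exists_iso_Q_obj_of_isLE n
  obtain ⟨g, hg⟩ := exists_Q_map_eq_of_isKProjective (e.inv ≫ f ≫ e'.hom)
  have hg0 : g = 0 := by
    ext i : 1
    by_cases hi : i < a
    · exact (hK i (Or.inl hi)).eq_of_src _ _
    · exact (L.isZero_of_isStrictlyLE n i (by lia)).eq_of_tgt _ _
  rw [hg0, Functor.map_zero] at hg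
  rw [← cancel_mono e'.hom, ← cancel_epi e.inv, ← hg]
  simp

end TStructure
end

noncomputable section

set_option linter.unusedSectionVars false

open Limits Pretriangulated ZeroObject MulOpposite

/-! ### Iterates of Serre functors and tensor powers of the Serre bimodule -/

namespace SerreFunctor

variable {k : Type*} [Field k] {T : Type*} [Category T] [Preadditive T] [Linear k T]
  (S : SerreFunctor k T)

/-- Every functional on `Hom(Y, S X)` is pairing with some `g`, and functionals separate vectors. -/
theorem eq_zero_of_duality_eq_zero {X Y : T} (h : Y ⟶ S.functor.obj X)
    (hh : ∀ g : X ⟶ Y, S.duality X Y g h = 0) : h = 0 := by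
  refine (Module.forall_dual_apply_eq_zero_iff k h).1 fun φ => ?_
  obtain ⟨g, rfl⟩ := (S.duality X Y).surjective φ
  exact hh g

theorem duality_comp_eq {X X' : T} (f : X' ⟶ X) (g : X ⟶ S.functor.obj X') :
    S.duality X _ g (S.functor.map f) = S.duality X' _ (f ≫ g) (𝟙 _) := by
  rw [S.naturality_left, Category.id_comp]

/-- Linearity is not part of the structure; it follows because the dualities determine the action of
`S` on morphisms. -/
instance : S.functor.Additive where
  map_add {X Y f g} := by
    refine sub_eq_zero.1 (S.eq_zero_of_duality_eq_zero _ fun h => ?_)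
    simp [duality_comp_eq]

instance : S.functor.Linear k where
  map_smul {X Y} f r := by
    refine sub_eq_zero.1 (S.eq_zero_of_duality_eq_zero _ fun h => ?_)
    simp [duality_comp_eq]

/-- If morphisms `X ⟶ R` are detected by morphisms `R ⟶ X`, then the morphisms `R ⟶ S X` are
generated by the morphisms `R ⟶ S R`. -/
theorem span_comp_map_eq_top {R X : T}
    (hX : ∀ g : X ⟶ R, (∀ x : R ⟶ X, x ≫ g = 0) → g = 0) :
    Submodule.span k {h | ∃ (f : R ⟶ S.functor.obj R) (x : R ⟶ X), h = f ≫ S.functor.map x} =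
      ⊤ := by
  by_contra hne
  -- A functional killing the span is pairing with some `g : X ⟶ R`. By naturality every `x ≫ g`
  -- pairs to zero with `Hom(R, S R)`, so `x ≫ g = 0` for all `x`, and then `g = 0` by detection.
  obtain ⟨φ, hφ, hle⟩ := Submodule.exists_le_ker_of_lt_top _ (lt_top_iff_ne_top.2 hne)
  obtain ⟨g, rfl⟩ := (S.duality X R).surjective φ
  refine hφ ?_
  rw [hX g fun x => ?_, map_zero]
  refine (S.duality R R).injective (LinearMap.ext fun f => ?_)
  rw [S.naturality_left, map_zero, LinearMap.zero_apply]
  exact hle (Submodule.subset_span ⟨f, x, rfl⟩)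

/-- The iterates of a Serre functor on objects. -/
def iter (X : T) : ℕ → T
  | 0 => X
  | m + 1 => S.functor.obj (iter X m)

theorem iterate_obj (X : T) (m : ℕ) : S.functor.obj^[m] X = S.iter X m := by
  induction m with
  | zero => rfl
  | succ m ih => rw [Function.iterate_succ_apply', ih, iter]

/-! ### The iterates `S^m X` and tensors over the endomorphism algebra of `R`. -/

section TensorPower

variable {A : Type*} [Ring A] [Algebra k A] {R : T} (ρ : A ≃ₗ[k] (R ⟶ R))

/-- The morphisms `R ⟶ S R` are identified with the Serre bimodule of the endomorphism algebra
of `R`. -/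
def toSerreBimodule : (R ⟶ S.functor.obj R) →ₗ[k] SerreBimodule k A :=
  ((S.duality R R).toLinearMap ∘ₗ ρ.toLinearMap).flip

theorem toSerreBimodule_apply (f : R ⟶ S.functor.obj R) (a : A) :
    S.toSerreBimodule ρ f a = S.duality R R (ρ a) f := rfl

theorem toSerreBimodule_bijective [FiniteDimensional k A] :
    Function.Bijective (S.toSerreBimodule ρ) := by
  have : Module.Finite k (Module.Dual k (R ⟶ S.functor.obj R)) :=
    (ρ.trans (S.duality R R)).finiteDimensional
  have : FiniteDimensional k (R ⟶ S.functor.obj R) := (Module.finite_dual_iff k).1 this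
  exact flip_bijective_of_bijective ((S.duality R R).toLinearMap ∘ₗ ρ.toLinearMap)
    ((S.duality R R).bijective.comp ρ.bijective)

variable (hρ : ∀ a b, ρ (b * a) = ρ a ≫ ρ b)

include hρ in
theorem toSerreBimodule_comp_map (a : A) (f : R ⟶ S.functor.obj R) :
    S.toSerreBimodule ρ (f ≫ S.functor.map (ρ a)) = a • S.toSerreBimodule ρ f := by
  refine DFunLike.ext _ _ fun x => ?_
  rw [SerreBimodule.smul_apply, toSerreBimodule_apply, toSerreBimodule_apply, hρ,
    S.naturality_left]

include hρ in
theorem toSerreBimodule_comp (a : A) (f : R ⟶ S.functor.obj R) :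
    S.toSerreBimodule ρ (ρ a ≫ f) = op a • S.toSerreBimodule ρ f := by
  refine DFunLike.ext _ _ fun x => ?_
  rw [SerreBimodule.op_smul_apply, toSerreBimodule_apply, toSerreBimodule_apply, hρ,
    S.naturality_right]

variable [FiniteDimensional k A]

/-- The inverse of `toSerreBimodule`. -/
def ofSerreBimodule : SerreBimodule k A ≃ₗ[k] (R ⟶ S.functor.obj R) :=
  (LinearEquiv.ofBijective (S.toSerreBimodule ρ) (S.toSerreBimodule_bijective ρ)).symm

theorem toSerreBimodule_ofSerreBimodule (f : SerreBimodule k A) :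
    S.toSerreBimodule ρ (S.ofSerreBimodule ρ f) = f :=
  (LinearEquiv.ofBijective (S.toSerreBimodule ρ)
    (S.toSerreBimodule_bijective ρ)).apply_symm_apply f

include hρ in
theorem ofSerreBimodule_smul (a : A) (f : SerreBimodule k A) :
    S.ofSerreBimodule ρ (a • f) = S.ofSerreBimodule ρ f ≫ S.functor.map (ρ a) := by
  apply (S.toSerreBimodule_bijective ρ).1
  rw [toSerreBimodule_comp_map S ρ hρ, toSerreBimodule_ofSerreBimodule,
    toSerreBimodule_ofSerreBimodule]

include hρ in
theorem ofSerreBimodule_op_smul (a : A) (f : SerreBimodule k A) :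
    S.ofSerreBimodule ρ (op a • f) = ρ a ≫ S.ofSerreBimodule ρ f := by
  apply (S.toSerreBimodule_bijective ρ).1
  rw [toSerreBimodule_comp S ρ hρ, toSerreBimodule_ofSerreBimodule,
    toSerreBimodule_ofSerreBimodule]

/-- The morphism `R ⟶ S Y` obtained from an element of the Serre bimodule and a morphism
`R ⟶ Y`. -/
def precompSerre (Y : T) :
    (R ⟶ Y) →ₗ[k] SerreBimodule k A →ₗ[k] (R ⟶ S.functor.obj Y) :=
  ((Linear.comp R (S.functor.obj R) (S.functor.obj Y)).flip ∘ₗ S.functor.mapLinearMap k).compl₂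
    (S.ofSerreBimodule ρ).toLinearMap

/-- The morphism `R ⟶ S^m X` obtained from `m` elements of the Serre bimodule and a morphism
`R ⟶ X`. -/
def iterHom {X : T} (x : R ⟶ X) :
    (m : ℕ) → MultilinearMap k (fun _ : Fin m => SerreBimodule k A) (R ⟶ S.iter X m)
  | 0 => MultilinearMap.constOfIsEmpty k _ x
  | m + 1 => MultilinearMap.uncurryRight (M := fun _ : Fin (m + 1) => SerreBimodule k A)
      ((S.precompSerre ρ (S.iter X m)).compMultilinearMap (iterHom x m))

theorem iterHom_succ {X : T} (x : R ⟶ X) (m : ℕ) (f : Fin (m + 1) → SerreBimodule k A) :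
    S.iterHom ρ x (m + 1) f = S.ofSerreBimodule ρ (f (Fin.last m)) ≫
      S.functor.map (S.iterHom ρ x m (Fin.init f)) := rfl

include hρ in
-- For the last two factors, the left action of `a` on one is composition with `S (ρ a)`.
-- Functoriality of `S` moves `ρ a` inside, where it is the right action on the preceding factor.
-- Other pairs of neighbours follow by induction.
theorem iterHom_balanced {X : T} (x : R ⟶ X) (m : ℕ) (f : Fin m → SerreBimodule k A)
    (i j : Fin m) (a : A) (hij : (j : ℕ) = i + 1) :
    S.iterHom ρ x m (Function.update f i (op a • f i)) =
      S.iterHom ρ x m (Function.update f j (a • f j)) := by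
  induction m with
  | zero => exact i.elim0
  | succ m ih =>
    induction i using Fin.lastCases with
    | last =>
      have := j.2
      simp only [Fin.val_last] at hij
      lia
    | cast i =>
      rw [iterHom_succ, iterHom_succ, Fin.init_update_castSucc,
        Function.update_of_ne (Fin.castSucc_lt_last i).ne']
      induction j using Fin.lastCases with
      | last =>
        cases m with
        | zero => exact i.elim0
        | succ m =>
          obtain rfl : i = Fin.last m := by
            ext
            simp only [Fin.val_last, Fin.val_castSucc] at hij ⊢
            lia
          rw [Fin.init_update_last, Function.update_self, ofSerreBimodule_smul S ρ hρ,
            Category.assoc, ← Functor.map_comp, iterHom_succ, iterHom_succ,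
            Fin.init_update_last, Function.update_self]
          have h : (f (Fin.last m).castSucc) = Fin.init f (Fin.last m) := rfl
          rw [h, ofSerreBimodule_op_smul S ρ hρ, Category.assoc]
          rfl
      | cast j =>
        rw [Fin.init_update_castSucc, Function.update_of_ne (Fin.castSucc_lt_last j).ne']
        congr 2
        exact ih (Fin.init f) i j hij

/-- Each step of the iteration applies `span_comp_map_eq_top`; the new map `R ⟶ S R` becomes the
last tensor factor. -/
theorem span_iterHom_eq_top {X : T}
    (hX : ∀ (m : ℕ) (g : S.iter X m ⟶ R), (∀ x : R ⟶ S.iter X m, x ≫ g = 0) → g = 0) (m : ℕ) :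
    Submodule.span k {h | ∃ (x : R ⟶ X) (f : Fin m → SerreBimodule k A),
      h = S.iterHom ρ x m f} = ⊤ := by
  induction m with
  | zero =>
    rw [eq_top_iff]
    exact fun x _ => Submodule.subset_span ⟨x, Fin.elim0, rfl⟩
  | succ m ih =>
    rw [eq_top_iff]
    refine (S.span_comp_map_eq_top (hX m)).ge.trans (Submodule.span_le.2 ?_)
    rintro _ ⟨f, y, rfl⟩
    have hy : y ∈ Submodule.span k {h | ∃ (x : R ⟶ X) (f : Fin m → SerreBimodule k A),
      h = S.iterHom ρ x m f} := by
      rw [ih]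
      trivial
    have hle : Submodule.span k {h | ∃ (x : R ⟶ X) (f : Fin m → SerreBimodule k A),
        h = S.iterHom ρ x m f} ≤ Submodule.comap
          (Linear.leftComp k _ f ∘ₗ S.functor.mapLinearMap k)
          (Submodule.span k {h | ∃ (x : R ⟶ X) (f : Fin (m + 1) → SerreBimodule k A),
            h = S.iterHom ρ x (m + 1) f}) := by
      refine Submodule.span_le.2 ?_
      rintro _ ⟨x, g, rfl⟩
      refine Submodule.subset_span ⟨x, Fin.snoc (α := fun _ => SerreBimodule k A) g
        ((S.ofSerreBimodule ρ).symm f), ?_⟩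
      rw [iterHom_succ, Fin.snoc_last, Fin.init_snoc, LinearEquiv.apply_symm_apply]
      rfl
    exact hle hy

include hρ in
/-- If morphisms from `S^m X` to `R` are detected by morphisms from `R`, and the `m`-fold tensor
power of the Serre bimodule of the endomorphism algebra of `R` vanishes, then there are no nonzero
morphisms from `R` to `S^m X`. -/
theorem subsingleton_hom_iter {X : T}
    (hX : ∀ (m : ℕ) (g : S.iter X m ⟶ R), (∀ x : R ⟶ S.iter X m, x ≫ g = 0) → g = 0) (m : ℕ)
    (hm : Subsingleton (BimoduleTensorPower k A (SerreBimodule k A) m)) (h : R ⟶ S.iter X m) :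
    h = 0 := by
  have hzero (x : R ⟶ X) : PiTensorProduct.lift (S.iterHom ρ x m) = 0 := by
    have hle : balancedRelations k A (SerreBimodule k A) m ≤
        LinearMap.ker (PiTensorProduct.lift (S.iterHom ρ x m)) := by
      refine Submodule.span_le.2 ?_
      rintro _ ⟨f, i, j, a, hij, rfl⟩
      rw [SetLike.mem_coe, LinearMap.mem_ker, map_sub, PiTensorProduct.lift.tprod,
        PiTensorProduct.lift.tprod, S.iterHom_balanced ρ hρ x m f i j a hij, sub_self]
    rw [Submodule.Quotient.subsingleton_iff.1 hm] at hle
    exact LinearMap.ker_eq_top.1 (top_le_iff.1 hle)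
  have hbot : Submodule.span k {h | ∃ (x : R ⟶ X) (f : Fin m → SerreBimodule k A),
      h = S.iterHom ρ x m f} = ⊥ := by
    rw [Submodule.span_eq_bot]
    rintro _ ⟨x, f, rfl⟩
    rw [← PiTensorProduct.lift.tprod, hzero, LinearMap.zero_apply]
  rw [S.span_iterHom_eq_top ρ hX] at hbot
  exact (Submodule.mem_bot k).1 (hbot ▸ Submodule.mem_top)

end TensorPower

end SerreFunctor
end

noncomputable section

set_option linter.unusedSectionVars false

open Limits Pretriangulated ZeroObject MulOpposite

/-! ### The lower Serre dimension -/

section LSdim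

variable {k : Type u} [Field k] {A : Type v} [Ring A] [Algebra k A]
  [HasDerivedCategory.{u'} (ModuleCat.{v} Aᵐᵒᵖ)]

theorem isPerfect_single_regularModule (n : ℤ) :
    isPerfect A ((DerivedCategory.singleFunctor _ n).obj (regularModule A)) :=
  (isPerfect A).prop_of_iso
    (((DerivedCategory.singleFunctors (ModuleCat.{v} Aᵐᵒᵖ)).shiftIso (-n) n 0 (by lia)).app
      (regularModule A))
    ((isPerfect A).le_shift (-n) _ (isPerfect_single A))

variable (A) in
/-- The regular module in degree `n` as a perfect complex. -/
def regularPerfAt (n : ℤ) : Perf A :=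
  ⟨(DerivedCategory.singleFunctor _ n).obj (regularModule A), isPerfect_single_regularModule n⟩

variable (k A) in
/-- The elements of an algebra are the endomorphisms of its regular module in degree `n`. -/
def regularPerfEnd (n : ℤ) : A ≃ₗ[k] (regularPerfAt A n ⟶ regularPerfAt A n) :=
  (regularModuleEnd k).trans
    ((homLinearEquivOfFullyFaithful k (DerivedCategory.singleFunctor _ n) (regularModule A)
      (regularModule A)).trans
      (homLinearEquivOfFullyFaithful k (isPerfect A).ι (regularPerfAt A n)
        (regularPerfAt A n)).symm)

theorem regularPerfEnd_mul (n : ℤ) (a b : A) :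
    regularPerfEnd k A n (b * a) = regularPerfEnd k A n a ≫ regularPerfEnd k A n b := by
  have h (x : A) : (regularPerfEnd k A n x).hom =
      (DerivedCategory.singleFunctor _ n).map (regularModuleEnd k x) :=
    (homLinearEquivOfFullyFaithful k (isPerfect A).ι (regularPerfAt A n)
      (regularPerfAt A n)).apply_symm_apply _
  apply ObjectProperty.hom_ext
  refine (h _).trans ?_
  rw [regularModuleEnd_mul, Functor.map_comp, ← h, ← h]
  rfl

variable (S : SerreFunctor k (Perf A))

/-- Serre functors are right t-exact. -/
theorem SerreFunctor.isLE_obj {X : Perf A} {n : ℤ} (hX : X.obj.IsLE n) :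
    (S.functor.obj X).obj.IsLE n := by
  refine isLE_of_hom_single_eq_zero _ n fun i hi f => ?_
  let f' : regularPerfAt A i ⟶ S.functor.obj X := ObjectProperty.homMk f
  suffices f' = 0 from congrArg (fun t => t.hom) this
  refine S.eq_zero_of_duality_eq_zero f' fun g => ?_
  have hg : g = 0 := by
    apply ObjectProperty.hom_ext
    exact DerivedCategory.TStructure.t.zero_of_isLE_of_isGE g.hom n i hi hX
      (inferInstanceAs (((DerivedCategory.singleFunctor _ i).obj (regularModule A)).IsGE i))
  rw [hg, map_zero, LinearMap.zero_apply]

theorem SerreFunctor.isLE_iter {X : Perf A} {n : ℤ} (hX : X.obj.IsLE n) (m : ℕ) :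
    (S.iter X m).obj.IsLE n := by
  induction m with
  | zero => exact hX
  | succ m ih => exact S.isLE_obj ih

variable [FiniteDimensional k A] {r : ℕ}
  (hr : Subsingleton (BimoduleTensorPower k A (SerreBimodule k A) r))

include hr in
-- Right t-exactness handles degrees above `n`. In degree `n`, maps from the regular module to `S^r
-- X` factor through the vanishing tensor power; detection holds because all iterates stay in
-- degrees `≤ n`.
theorem SerreFunctor.isLE_iter_sub_one {X : Perf A} {n : ℤ} (hX : X.obj.IsLE n) :
    (S.iter X r).obj.IsLE (n - 1) := by
  refine isLE_of_hom_single_eq_zero _ _ fun i hi f => ?_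
  rcases (show n ≤ i by lia).lt_or_eq with hi' | rfl
  · exact hom_single_eq_zero_of_isLE n i hi' (S.isLE_iter hX r) f
  · let f' : regularPerfAt A n ⟶ S.iter X r := ObjectProperty.homMk f
    suffices f' = 0 from congrArg (fun t => t.hom) this
    refine S.subsingleton_hom_iter (regularPerfEnd k A n) (regularPerfEnd_mul n)
      (fun m g hg => ?_) r hr f'
    apply ObjectProperty.hom_ext
    refine eq_zero_of_single_comp_eq_zero (S.isLE_iter hX m) g.hom fun x => ?_
    exact congrArg (fun t => t.hom) (hg (ObjectProperty.homMk x))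

theorem SerreFunctor.iter_add (X : Perf A) (m n : ℕ) :
    S.iter X (m + n) = S.iter (S.iter X m) n := by
  rw [← S.iterate_obj, ← S.iterate_obj, ← S.iterate_obj, add_comm, Function.iterate_add_apply]

include hr in
theorem SerreFunctor.isLE_iter_div {X : Perf A} {n : ℤ} (hX : X.obj.IsLE n) (m : ℕ) :
    (S.iter X m).obj.IsLE (n - (m / r : ℕ)) := by
  have h (j : ℕ) : (S.iter X (r * j)).obj.IsLE (n - j) := by
    induction j with
    | zero =>
      rw [Nat.mul_zero, Nat.cast_zero, sub_zero]
      exact hX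
    | succ j ih =>
      rw [Nat.mul_succ, S.iter_add]
      have := S.isLE_iter_sub_one hr ih
      rwa [sub_sub, ← Nat.cast_succ] at this
  rw [← Nat.div_add_mod m r, S.iter_add]
  have := S.isLE_iter (h (m / r)) (m % r)
  rwa [Nat.div_add_mod]

include hr in
-- With `G` in degrees `≤ n` and no maps from `G` to objects in degrees `< a`, a nonzero map to
-- `(S^m G)[i]` forces `n - ⌊m/r⌋ - i ≥ a`. The constant is thus `n - a`.
theorem SerreFunctor.exists_supHom_le (G : Perf A) :
    ∃ c : ℤ, ∀ m : ℕ, supHom G (S.functor.obj^[m] G) ≤ ((c - (m / r : ℕ) : ℝ) : EReal) := by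
  obtain ⟨n, hn⟩ := exists_isLE_of_isPerfect G.property
  obtain ⟨a, ha⟩ := exists_hom_eq_zero_of_isPerfect G.property
  refine ⟨n - a, fun m => sSup_le ?_⟩
  rintro _ ⟨i, hi, rfl⟩
  rw [S.iterate_obj] at hi
  have hle := S.isLE_iter_div hr hn m
  by_contra hlt
  have hlt' : (n - a : ℤ) - ((m / r : ℕ) : ℤ) < i := by
    rw [not_le, EReal.coe_lt_coe_iff] at hlt
    generalize m / r = q at hlt ⊢
    rw [← Int.cast_natCast, ← Int.cast_sub] at hlt
    exact Int.cast_lt.1 hlt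
  have hshift := DerivedCategory.TStructure.t.isLE_shift (S.iter G m).obj
    (n - (m / r : ℕ)) i (n - (m / r : ℕ) - i) (by lia)
  exact not_subsingleton_iff_nontrivial.2 hi
    (subsingleton_of_forall_eq 0 (ha _ _ (by lia) hshift))

include hr in
theorem SerreFunctor.one_div_le_LSdim (hr0 : 0 < r) (G : Perf A) :
    ((1 / (r : ℝ) : ℝ) : EReal) ≤ LSdim S.functor G := by
  obtain ⟨c, hc⟩ := S.exists_supHom_le hr G
  -- The extra `1` in the error term `(1 + c) / m` absorbs the rounding in `m / r`.
  have hlim : Tendsto (fun m : ℕ => (1 / (r : ℝ) - (1 + c) / m : ℝ)) atTop (nhds (1 / (r : ℝ))) := by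
    simpa using (tendsto_const_div_atTop_nhds_zero_nat ((1 : ℝ) + c)).const_sub (1 / (r : ℝ))
  have hlim' := (EReal.tendsto_coe.2 hlim).liminf_eq
  rw [← hlim']
  refine liminf_le_liminf ?_
  filter_upwards [eventually_gt_atTop 0] with m hm
  have hm' : (0 : ℝ) < m := Nat.cast_pos.2 hm
  have hr' : (0 : ℝ) < r := Nat.cast_pos.2 hr0
  have h1 : ((-(c - (m / r : ℕ) : ℝ) : ℝ) : EReal) ≤ -supHom G (S.functor.obj^[m] G) := by
    rw [EReal.coe_neg]
    exact EReal.neg_le_neg_iff.2 (hc m)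
  refine le_trans ?_ (EReal.div_le_div_right_of_nonneg (by positivity) h1)
  rw [← EReal.coe_natCast, ← EReal.coe_div, EReal.coe_le_coe_iff, le_div_iff₀ hm']
  have h2 : (m : ℝ) / r < (m / r : ℕ) + 1 := by
    rw [div_lt_iff₀' hr']
    exact_mod_cast Nat.lt_mul_div_succ m hr0
  have h3 : (1 / (r : ℝ) - (1 + c) / m) * m = m / r - (1 + c) := by
    field_simp
  rw [h3]
  linarith

end LSdim
end

noncomputable section

set_option linter.unusedSectionVars false

open Limits Pretriangulated ZeroObject MulOpposite

/-! ### Vanishing of tensor powers of bimodules -/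

section TensorPower

variable {k : Type*} [Field k] {A : Type*} [Ring A] {B : Type*} [AddCommGroup B] [Module k B]
  [Module A B] [Module Aᵐᵒᵖ B]

variable (k A B) in
/-- Pure tensors in a tensor power of a bimodule. -/
def bimoduleTprod (n : ℕ) :
    MultilinearMap k (fun _ : Fin n => B) (BimoduleTensorPower k A B n) :=
  (balancedRelations k A B n).mkQ.compMultilinearMap (PiTensorProduct.tprod k)

theorem bimoduleTprod_balanced {n : ℕ} (f : Fin n → B) (i j : Fin n) (a : A)
    (hij : (j : ℕ) = i + 1) :
    bimoduleTprod k A B n (Function.update f i (op a • f i)) =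
      bimoduleTprod k A B n (Function.update f j (a • f j)) :=
  (Submodule.Quotient.eq _).2 (Submodule.subset_span ⟨f, i, j, a, hij, rfl⟩)

theorem bimoduleTprod_update_op_smul {n : ℕ} (f : Fin n → B) (i j : Fin n) (a : A) (g : B)
    (hij : (j : ℕ) = i + 1) :
    bimoduleTprod k A B n (Function.update f i (op a • g)) =
      bimoduleTprod k A B n (Function.update (Function.update f i g) j (a • f j)) := by
  have hne : j ≠ i := fun h => by
    rw [h] at hij
    lia
  have h := bimoduleTprod_balanced (k := k) (Function.update f i g) i j a hij
  rwa [Function.update_self, Function.update_idem, Function.update_of_ne hne] at h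

theorem subsingleton_bimoduleTensorPower_of_tprod {n : ℕ}
    (h : ∀ f, bimoduleTprod k A B n f = 0) : Subsingleton (BimoduleTensorPower k A B n) := by
  rw [Submodule.Quotient.subsingleton_iff, eq_top_iff, ← PiTensorProduct.span_tprod_eq_top,
    Submodule.span_le]
  rintro _ ⟨f, rfl⟩
  exact (Submodule.Quotient.mk_eq_zero _).1 (h f)

/-- A criterion for the vanishing of a tensor power of a bimodule: the factors of a pure tensor
can be moved to the right along the degree function `d` on the idempotents `e i`, until they
are killed. -/
theorem subsingleton_bimoduleTensorPower {V : Type*} [Fintype V] {e : V → A} (he : ∑ i, e i = 1)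
    (hidem : ∀ i, e i * e i = e i) (d : V → ℕ) (l : ℕ) (hd : ∀ i, d i ≤ l)
    (H : ∀ i, (∀ f : B, e i • f = f → f ∈ Submodule.span k
        {b | ∃ (j : V) (a : A) (g : B), d i < d j ∧ b = op a • op (e j) • g}) ∨
      ∃ a : A, ∀ f : B, e i • f = f → op (e i) • f = f ∧ op a • f = 0 ∧ ∃ h : B, f = a • h) :
    Subsingleton (BimoduleTensorPower k A B (l + 2)) := by
  -- A factor in `e_i B` stands at position `p`, with `p ≤ d i` maintained throughout; `m` bounds
  -- the number of positions still available from `p` on.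
  have key (m : ℕ) : ∀ (p q : Fin (l + 2)) (f : Fin (l + 2) → B) (i : V), l + 2 ≤ p + m → (q : ℕ) = p + 1 →
      (p : ℕ) ≤ d i → e i • f p = f p → bimoduleTprod k A B (l + 2) f = 0 := by
    induction m with
    | zero =>
      intro p q f i hm
      have := p.2
      lia
    | succ m ih =>
      intro p q f i hm hpq hpi hf
      rcases H i with hi | ⟨a, ha⟩
      · have hle : Submodule.span k
            {b | ∃ (j : V) (a : A) (g : B), d i < d j ∧ b = op a • op (e j) • g} ≤
            LinearMap.ker ((bimoduleTprod k A B (l + 2)).toLinearMap f p) := by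
          rw [Submodule.span_le]
          rintro _ ⟨j, a, g, hij, rfl⟩
          change bimoduleTprod k A B (l + 2) (Function.update f p (op a • op (e j) • g)) = 0
          have hdj := hd j
          rw [bimoduleTprod_update_op_smul f p q a _ hpq]
          have hne : p ≠ q := fun h => by
            rw [h] at hpq
            lia
          rw [Function.update_comm hne, bimoduleTprod_update_op_smul _ p q (e j) _ hpq,
            Function.update_self]
          -- Both `a` and `e_j` have crossed to position `q`, whose factor now lies in `e_j B`. From
          -- `p ≤ d i < d j ≤ l` it follows that `q ≤ d j` and that position `p + 2` exists, which
          -- is where `l + 2` factors are needed.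
          refine ih q ⟨p + 2, by lia⟩ _ j (by lia) (by simp [hpq]) (by lia) ?_
          rw [Function.update_self, smul_smul, hidem]
        have h0 := hle (hi _ hf)
        change bimoduleTprod k A B (l + 2) (Function.update f p (f p)) = 0 at h0
        rwa [Function.update_eq_self] at h0
      -- The terminal case: `f_p ⊗ f_q = f_p e_i ⊗ f_q = f_p ⊗ e_i f_q = f_p ⊗ a h = f_p a ⊗ h = 0`.
      · obtain ⟨h1, h2, -⟩ := ha _ hf
        have hq : e i • e i • f q = e i • f q := by rw [smul_smul, hidem]
        obtain ⟨-, -, h, hh⟩ := ha _ hq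
        have h3 := bimoduleTprod_balanced (k := k) f p q (e i) hpq
        rw [h1, Function.update_eq_self] at h3
        have hne : p ≠ q := fun h => by
          rw [h] at hpq
          lia
        have h4 := bimoduleTprod_balanced (k := k) (Function.update f q h) p q a hpq
        rw [Function.update_self, Function.update_idem, Function.update_of_ne hne, h2] at h4
        rw [h3, hh, ← h4]
        exact (bimoduleTprod k A B (l + 2)).map_coord_zero p (Function.update_self _ _ _)
  refine subsingleton_bimoduleTensorPower_of_tprod fun f => ?_
  have h1 : f = Function.update f 0 (∑ i, e i • f 0) := by
    rw [← Finset.sum_smul, he, one_smul, Function.update_eq_self]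
  rw [h1, MultilinearMap.map_update_sum]
  refine Finset.sum_eq_zero fun i _ => ?_
  refine key (l + 2) 0 1 _ i (by simp) (by simp) (by simp) ?_
  rw [Function.update_self, smul_smul, hidem]

/-! ### The Serre bimodule of a directed algebra -/

end TensorPower

section Directed

variable {k : Type*} [Field k] {A : Type*} [Ring A] [Algebra k A] {V : Type*} [Fintype V]
  [LinearOrder V] {e : V → A} (he : IsDirectedFamily k e)

theorem SerreBimodule.exists_apply_eq_one {a : A} (ha : a ≠ 0) :
    ∃ φ : SerreBimodule k A, φ a = 1 := by
  obtain ⟨φ, hφ⟩ := not_forall.1 (mt (Module.forall_dual_apply_eq_zero_iff k a).1 ha)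
  exact ⟨((φ a)⁻¹ • φ : Module.Dual k A), inv_mul_cancel₀ hφ⟩

theorem SerreBimodule.map_smul (f : SerreBimodule k A) (c : k) (a : A) : f (c • a) = c * f a :=
  LinearMap.map_smul (f : A →ₗ[k] k) c a

include he in
theorem IsDirectedFamily.sum_op_smul (f : SerreBimodule k A) :
    f = ∑ j, op (e j) • f := by
  rw [← Finset.sum_smul, ← Finset.op_sum, he.complete, MulOpposite.op_one, one_smul]

include he in
/-- A functional supported on `A e_i` is a sum of functionals supported on `e_j A e_i` and
multiples of such, if there is a nonzero element in `e_j A e_i`. -/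
theorem IsDirectedFamily.mem_span_op_smul (d : V → ℕ) {i j : V} (hij : d i < d j) (a : A)
    (ha : a ≠ 0) (hae : e j * a * e i = a)
    (hd : ∀ j, j ≠ i → (∀ x, e j * x * e i = 0) ∨ d i < d j)
    (f : SerreBimodule k A) (hf : e i • f = f) :
    f ∈ Submodule.span k {b | ∃ (j : V) (a : A) (g : SerreBimodule k A),
      d i < d j ∧ b = op a • op (e j) • g} := by
  have hfe (x : A) : f (x * e i) = f x := DFunLike.congr_fun hf x
  have hf0 := he.sum_op_smul f
  rw [hf0]
  refine Submodule.sum_mem _ fun t _ => ?_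
  by_cases ht : t = i
  · subst ht
    obtain ⟨φ, hφ⟩ := SerreBimodule.exists_apply_eq_one (k := k) ha
    -- On `e_t A e_t = k e_t` only the scalar `f (e t)` matters. Left multiplication by `a` embeds
    -- this line into `e_j A e_t`, where `φ`, normalized by `φ a = 1`, recovers it.
    refine Submodule.subset_span ⟨j, a, f (e t) • e t • φ, hij, ?_⟩
    refine DFunLike.ext _ _ fun x => ?_
    change f (e t * x) = f (e t) * φ (e j * (a * x) * e t)
    obtain ⟨c, hc⟩ := he.exists_smul t x
    have h1 : e j * (a * x) * e t = c • a := by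
      calc e j * (a * x) * e t = (e j * (e j * a * e t)) * x * e t := by
            rw [hae]
            noncomm_ring
        _ = (e j * e j) * a * (e t * x * e t) := by noncomm_ring
        _ = c • a := by
            rw [hc, (he.idem j).eq, mul_smul_comm, hae]
    have h2 : f (e t * x) = c * f (e t) := by
      rw [← hfe, hc]
      exact SerreBimodule.map_smul f c (e t)
    have h3 : φ (c • a) = c := by rw [SerreBimodule.map_smul, hφ, mul_one]
    rw [h1, h2, h3, mul_comm]
  · rcases hd t ht with h | h
    · convert Submodule.zero_mem _
      refine DFunLike.ext _ _ fun x => ?_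
      change f (e t * x) = 0
      rw [← hfe, h]
      exact LinearMap.map_zero (f : A →ₗ[k] k)
    · refine Submodule.subset_span ⟨t, e t, f, h, ?_⟩
      rw [smul_smul, ← MulOpposite.op_mul, (he.idem t).eq]

include he in
/-- The functionals supported on `A e_i`, if this is one-dimensional and there is a nonzero
element in `e_i A e_j`. -/
theorem IsDirectedFamily.exists_smul_eq_of_sink {i j : V} (hij : j ≠ i) (a : A)
    (ha : a ≠ 0) (hae : e i * a * e j = a) (hi : ∀ j, j ≠ i → ∀ x, e j * x * e i = 0)
    (f : SerreBimodule k A) (hf : e i • f = f) :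
    op (e i) • f = f ∧ op a • f = 0 ∧ ∃ h : SerreBimodule k A, f = a • h := by
  have hfe (x : A) : f (x * e i) = f x := DFunLike.congr_fun hf x
  have hf0 : f 0 = 0 := LinearMap.map_zero (f : A →ₗ[k] k)
  have hxe (x : A) : x * e i = e i * x * e i := by
    calc x * e i = (∑ t, e t) * x * e i := by rw [he.complete, one_mul]
      _ = ∑ t, e t * x * e i := by rw [Finset.sum_mul, Finset.sum_mul]
      _ = e i * x * e i := Finset.sum_eq_single i (fun t _ ht => hi t ht x) (by simp)
  refine ⟨DFunLike.ext _ _ fun x => ?_, DFunLike.ext _ _ fun x => ?_, ?_⟩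
  · rw [SerreBimodule.op_smul_apply, ← hfe, ← hxe, hfe]
  · rw [SerreBimodule.op_smul_apply, ← hfe, ← hae]
    have : e i * a * e j * x * e i = e i * a * (e j * x * e i) := by noncomm_ring
    rw [this, hi j hij, mul_zero, hf0]
    rfl
  · obtain ⟨φ, hφ⟩ := SerreBimodule.exists_apply_eq_one (k := k) ha
    -- As `A e_i = k e_i`, right multiplication by `a` sends `c e_i` to `c a`, which `φ` reads off.
    refine ⟨f (e i) • φ, DFunLike.ext _ _ fun x => ?_⟩
    change f x = f (e i) * φ (x * a)
    obtain ⟨c, hc⟩ := he.exists_smul i x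
    have h1 : x * a = c • a := by
      calc x * a = (x * e i) * a * e j := by
            rw [mul_assoc x, mul_assoc x, hae]
        _ = c • a := by rw [hxe, hc, smul_mul_assoc, smul_mul_assoc, hae]
    have h2 : f x = c * f (e i) := by
      rw [← hfe, hxe, hc]
      exact SerreBimodule.map_smul f c (e i)
    have h3 : φ (c • a) = c := by rw [SerreBimodule.map_smul, hφ, mul_one]
    rw [h1, h2, h3, mul_comm]

end Directed
end

noncomputable section

set_option linter.unusedSectionVars false

/-! ### Paths in ordered quivers -/

namespace Quiver

variable {V : Type v} [Quiver.{w} V]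

theorem IsOrdered.eq_or_lt [LinearOrder V] (hV : IsOrdered V) {a b : V} (p : Path a b) :
    (∃ h : a = b, p = h ▸ Path.nil) ∨ a < b := by
  induction p with
  | nil => exact Or.inl ⟨rfl, rfl⟩
  | cons p f ih =>
    rcases ih with ⟨h, -⟩ | h
    · exact Or.inr (h.trans_lt (hV _ _ f))
    · exact Or.inr (h.trans (hV _ _ f))

/-- Induction on the target: a nonempty path ends with an arrow from a smaller vertex, leaving
finitely many choices. -/
theorem IsOrdered.finite_path [LinearOrder V] [Finite V] (hV : IsOrdered V)
    (hfin : ∀ a b : V, Finite (a ⟶ b)) (a b : V) : Finite (Path a b) := by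
  induction b using WellFoundedLT.induction with
  | ind b ih =>
    have (c : {c // c < b}) : Finite (Path a c.1) := ih c.1 c.2
    let φ : Path a b → Option (Σ c : {c // c < b}, Path a c.1 × (c.1 ⟶ b)) := fun p =>
      match p with
      | .nil => none
      | .cons q f => some ⟨⟨_, hV _ _ f⟩, q, f⟩
    refine Finite.of_injective φ fun p q hpq => ?_
    cases p with
    | nil =>
      cases q with
      | nil => rfl
      | cons q f => simp [φ] at hpq
    | cons p f =>
      cases q with
      | nil => simp [φ] at hpq
      | cons q g =>
        simp only [φ, Option.some.injEq, Sigma.mk.injEq, Subtype.mk.injEq] at hpq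
        obtain ⟨rfl, h⟩ := hpq
        simp only [heq_eq_eq, Prod.mk.injEq] at h
        rw [h.1, h.2]

/-- In a connected quiver with more than one vertex, every vertex is the end of an arrow. -/
theorem IsConnected.exists_hom [Nontrivial V] (hV : IsConnected V) (i : V) :
    (∃ j : V, Nonempty (i ⟶ j)) ∨ ∃ j : V, Nonempty (j ⟶ i) := by
  obtain ⟨j, hj⟩ := exists_ne i
  have h : (WeaklyConnectedComponent.mk j : WeaklyConnectedComponent V) =
      WeaklyConnectedComponent.mk i := hV.2.elim _ _
  obtain ⟨p⟩ := (WeaklyConnectedComponent.eq j i).1 h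
  cases p with
  | nil => exact absurd rfl hj
  | cons p f =>
    rcases f with f | f
    · exact Or.inr ⟨_, ⟨f⟩⟩
    · exact Or.inl ⟨_, ⟨f⟩⟩

/-- The maximal length of a path ending at a vertex. -/
def depth (j : V) : ℕ := sSup {n | ∃ (a : V) (p : Path a j), p.length = n}

variable {l : ℕ}

theorem HasLength.bddAbove (hl : HasLength V l) (j : V) :
    BddAbove {n | ∃ (a : V) (p : Path a j), p.length = n} :=
  ⟨l, fun _ ⟨a, p, hp⟩ => hl.2 ⟨a, j, p, hp⟩⟩

theorem HasLength.exists_length_eq_depth (hl : HasLength V l) (j : V) :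
    ∃ (a : V) (p : Path a j), p.length = depth j :=
  Nat.sSup_mem (s := {n | ∃ (a : V) (p : Path a j), p.length = n}) ⟨0, j, .nil, rfl⟩
    (hl.bddAbove j)

theorem HasLength.depth_le (hl : HasLength V l) (j : V) : depth j ≤ l := by
  obtain ⟨a, p, hp⟩ := hl.exists_length_eq_depth j
  exact hl.2 ⟨a, j, p, hp⟩

/-- A longest path ending at `i` is prolonged by `p`. -/
theorem HasLength.depth_lt (hl : HasLength V l) {i j : V} (p : Path i j) (hp : 0 < p.length) :
    depth i < depth j := by
  obtain ⟨a, q, hq⟩ := hl.exists_length_eq_depth i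
  have : (q.comp p).length ≤ depth j := le_csSup (hl.bddAbove j) ⟨a, q.comp p, rfl⟩
  rw [Path.length_comp] at this
  lia

end Quiver

/-! ### Path algebras with relations -/

namespace PathAlgebra

variable {k : Type u} [Field k] {V : Type v} [Quiver.{w} V] [Fintype V]

/-- A product of two paths of positive length is zero or a path of length at least two, hence never
an arrow. -/
theorem coord_eq_zero_of_mem_arrowIdeal_sq [DecidableEq V] {a b : V} (f : a ⟶ b)
    {x : PathAlgebra k V} (hx : x ∈ arrowIdeal k V ^ 2) :
    (pathBasis k V).coord ⟨a, b, f.toPath⟩ x = 0 := by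
  rw [← LinearMap.mem_ker]
  refine (?_ : arrowIdeal k V ^ 2 ≤ _) hx
  rw [pow_two, arrowIdeal, Submodule.span_mul_span, Submodule.span_le]
  rintro _ ⟨_, ⟨⟨c, d, p⟩, hp, rfl⟩, _, ⟨⟨c', d', q⟩, hq, rfl⟩, rfl⟩
  rw [SetLike.mem_coe, LinearMap.mem_ker]
  by_cases h : c = d'
  · subst h
    have h1 : (⟨c', d, q.comp p⟩ : QuiverPath V) ≠ ⟨a, b, f.toPath⟩ := fun h => by
      have h2 : (q.comp p).length = f.toPath.length :=
        congrArg (fun t : QuiverPath V => t.2.2.length) h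
      rw [Quiver.Path.length_comp, Quiver.Path.length_toPath] at h2
      dsimp only at hp hq
      lia
    change (pathBasis k V).coord _ (ofPath k ⟨c, d, p⟩ * ofPath k ⟨c', c, q⟩) = 0
    rw [ofPath_mul_ofPath_comp, ofPath, Module.Basis.coord_apply, Module.Basis.repr_self,
      Finsupp.single_eq_of_ne h1.symm]
  · change (pathBasis k V).coord _ (ofPath k ⟨c, d, p⟩ * ofPath k ⟨c', d', q⟩) = 0
    rw [ofPath_mul_ofPath_of_ne _ _ h, map_zero]

variable [LinearOrder V] {I : TwoSidedIdeal (PathAlgebra k V)}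

variable (I) in
/-- The quotient map from the path algebra to the path algebra with relations. -/
def toWithRelations : PathAlgebra k V →ₐ[k] WithRelations I :=
  { I.ringCon.mk' with commutes' := fun _ => rfl }

theorem toWithRelations_surjective : Function.Surjective (toWithRelations I) :=
  I.ringCon.mk'_surjective

theorem toWithRelations_eq_zero_iff {x : PathAlgebra k V} : toWithRelations I x = 0 ↔ x ∈ I := by
  rw [TwoSidedIdeal.mem_iff, ← RingCon.eq]
  rfl

variable (I) in
/-- The class of a path in the path algebra with relations. -/
def pathClass {a b : V} (p : Quiver.Path a b) : WithRelations I :=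
  toWithRelations I (ofPath k ⟨a, b, p⟩)

theorem pathClass_mul_comp {a b c : V} (q : Quiver.Path a b) (p : Quiver.Path b c) :
    pathClass I p * pathClass I q = pathClass I (q.comp p) := by
  rw [pathClass, pathClass, ← map_mul, ofPath_mul_ofPath_comp, pathClass]

theorem pathClass_mul_of_ne {a b b' c : V} (q : Quiver.Path a b') (p : Quiver.Path b c)
    (h : b ≠ b') : pathClass I p * pathClass I q = 0 := by
  rw [pathClass, pathClass, ← map_mul, ofPath_mul_ofPath_of_ne _ _ h, map_zero]

variable (I) in
/-- The idempotent of a vertex. -/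
def vertexIdem (i : V) : WithRelations I := pathClass I (Quiver.Path.nil : Quiver.Path i i)

theorem vertexIdem_mul_pathClass {a b : V} (p : Quiver.Path a b) :
    vertexIdem I b * pathClass I p = pathClass I p := pathClass_mul_comp p .nil

theorem pathClass_mul_vertexIdem {a b : V} (p : Quiver.Path a b) :
    pathClass I p * vertexIdem I a = pathClass I p := by
  rw [vertexIdem, pathClass_mul_comp, Quiver.Path.nil_comp]

/-- The space `e_i A e_j` is spanned by the classes of the paths from `j` to `i`. -/
theorem vertexIdem_mul_mul_mem (i j : V) (P : Submodule k (WithRelations I))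
    (hP : ∀ p : Quiver.Path j i, pathClass I p ∈ P) (x : WithRelations I) :
    vertexIdem I i * x * vertexIdem I j ∈ P := by
  obtain ⟨x, rfl⟩ := toWithRelations_surjective x
  induction x using induction_ofPath with
  | zero => simp
  | add x y hx hy =>
    rw [map_add, mul_add, add_mul]
    exact P.add_mem hx hy
  | smul c x hx =>
    rw [map_smul, mul_smul_comm, smul_mul_assoc]
    exact P.smul_mem c hx
  | path p =>
    obtain ⟨a, b, p⟩ := p
    change vertexIdem I i * pathClass I p * vertexIdem I j ∈ P
    by_cases hb : i = b
    · subst hb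
      rw [vertexIdem_mul_pathClass]
      by_cases ha : a = j
      · subst ha
        rw [pathClass_mul_vertexIdem]
        exact hP p
      · rw [vertexIdem, pathClass_mul_of_ne _ _ ha]
        exact P.zero_mem
    · rw [vertexIdem, pathClass_mul_of_ne _ _ hb, zero_mul]
      exact P.zero_mem

theorem completeOrthogonalIdempotents_vertexIdem :
    CompleteOrthogonalIdempotents (vertexIdem I) where
  idem i := vertexIdem_mul_pathClass _
  ortho i j h := pathClass_mul_of_ne _ _ h
  complete := by
    have h : (1 : PathAlgebra k V) = ∑ i : V, ofPath k ⟨i, i, Quiver.Path.nil⟩ := rfl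
    rw [← map_one (toWithRelations I), h, map_sum]
    rfl

theorem isDirectedFamily_vertexIdem (hord : Quiver.IsOrdered V) :
    IsDirectedFamily k (vertexIdem I) where
  toCompleteOrthogonalIdempotents := completeOrthogonalIdempotents_vertexIdem
  eq_zero_of_lt i j x hij := by
    refine (Submodule.mem_bot k).1 (vertexIdem_mul_mul_mem i j ⊥ (fun p => ?_) x)
    rcases hord.eq_or_lt p with ⟨h, -⟩ | h
    · exact absurd h hij.ne'
    · exact absurd h hij.not_gt
  exists_smul i x := by
    have h : vertexIdem I i * x * vertexIdem I i ∈ Submodule.span k {vertexIdem I i} := by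
      refine vertexIdem_mul_mul_mem i i _ (fun p => ?_) x
      rcases hord.eq_or_lt p with ⟨h, hp⟩ | h
      · rw [hp]
        exact Submodule.mem_span_singleton_self _
      · exact absurd h (lt_irrefl i)
    obtain ⟨c, hc⟩ := Submodule.mem_span_singleton.1 h
    exact ⟨c, hc.symm⟩

theorem finiteDimensional_withRelations (hfin : ∀ a b : V, Finite (a ⟶ b))
    (hord : Quiver.IsOrdered V) : FiniteDimensional k (WithRelations I) := by
  have := hord.finite_path hfin
  have : Finite (QuiverPath V) := inferInstance
  have : FiniteDimensional k (PathAlgebra k V) := Module.Finite.of_basis (pathBasis k V)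
  exact Module.Finite.of_surjective (toWithRelations I).toLinearMap toWithRelations_surjective

/-- The role of `I ⊂ R²`: no arrow becomes zero in the quotient. -/
theorem pathClass_toPath_ne_zero (hI : IsIdealOfRelations I) {a b : V} (f : a ⟶ b) :
    pathClass I f.toPath ≠ 0 := by
  intro h
  have h1 := coord_eq_zero_of_mem_arrowIdeal_sq f (hI _ (toWithRelations_eq_zero_iff.1 h))
  rw [ofPath, Module.Basis.coord_apply, Module.Basis.repr_self, Finsupp.single_eq_same] at h1
  exact one_ne_zero h1

/-- The criterion is applied with depth as degree function. An outgoing arrow at `i` gives the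
moving alternative; at a sink, connectedness gives an incoming arrow and hence the killing
alternative. -/
theorem subsingleton_bimoduleTensorPower_serreBimodule (hord : Quiver.IsOrdered V)
    (hconn : Quiver.IsConnected V) [Nontrivial V] {l : ℕ} (hl : Quiver.HasLength V l)
    (hI : IsIdealOfRelations I) :
    Subsingleton (BimoduleTensorPower k (WithRelations I)
      (SerreBimodule k (WithRelations I)) (l + 2)) := by
  have he := isDirectedFamily_vertexIdem (I := I) hord
  refine subsingleton_bimoduleTensorPower he.complete (fun i => he.idem i) Quiver.depth l
    hl.depth_le fun i => ?_
  have hpath {a b : V} (p : Quiver.Path a b) :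
      vertexIdem I b * pathClass I p * vertexIdem I a = pathClass I p := by
    rw [vertexIdem_mul_pathClass, pathClass_mul_vertexIdem]
  have hlen {a b : V} (p : Quiver.Path a b) (h : b ≠ a) : 0 < p.length :=
    Nat.pos_of_ne_zero fun h0 => h (Quiver.Path.eq_of_length_zero p h0).symm
  by_cases hi : ∃ j : V, Nonempty (i ⟶ j)
  · obtain ⟨j, ⟨f⟩⟩ := hi
    refine Or.inl (he.mem_span_op_smul Quiver.depth (hl.depth_lt f.toPath Nat.one_pos) _
      (pathClass_toPath_ne_zero hI f) (hpath _) fun t ht => ?_)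
    by_cases h : Nonempty (Quiver.Path i t)
    · exact Or.inr (hl.depth_lt h.some (hlen _ ht))
    · exact Or.inl fun x => (Submodule.mem_bot k).1
        (vertexIdem_mul_mul_mem t i ⊥ (fun p => absurd ⟨p⟩ h) x)
  · obtain ⟨j, ⟨f⟩⟩ := (hconn.exists_hom i).resolve_left hi
    refine Or.inr ⟨_, he.exists_smul_eq_of_sink (hord _ _ f).ne _ (pathClass_toPath_ne_zero hI f)
      (hpath _) fun t ht x => (Submodule.mem_bot k).1
        (vertexIdem_mul_mul_mem t i ⊥ (fun p => ?_) x)⟩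
    -- A path from the sink `i` to a different vertex would begin with an arrow leaving `i`.
    obtain ⟨c, g, q, hq⟩ : ∃ (c : V) (g : i ⟶ c) (q : Quiver.Path c t), p = g.toPath.comp q :=
      Quiver.Path.eq_toPath_comp_of_length_eq_succ p (Nat.succ_pred_eq_of_pos (hlen p ht)).symm
        |>.imp fun c hc => by
          obtain ⟨g, q, -, h⟩ := hc
          exact ⟨g, q, h⟩
    exact absurd ⟨c, ⟨g⟩⟩ hi

end PathAlgebra
end

theorem mainTheorem3 {k : Type u} [Field k] {V : Type v} [Quiver.{w} V] [Fintype V]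
    [LinearOrder V] (hfin : ∀ a b : V, Finite (a ⟶ b)) (hord : Quiver.IsOrdered V)
    (hconn : Quiver.IsConnected V) (hnontriv : Nontrivial V)
    (l : ℕ) (hl : Quiver.HasLength V l)
    (I : TwoSidedIdeal (PathAlgebra k V)) (hI : PathAlgebra.IsIdealOfRelations I)
    [HasDerivedCategory.{u'} (ModuleCat.{max u v w} (PathAlgebra.WithRelations I)ᵐᵒᵖ)] :
    Nonempty (SerreFunctor k (Perf (PathAlgebra.WithRelations I))) ∧
    (∃ G : Perf (PathAlgebra.WithRelations I), IsClassicalGenerator G) ∧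
    (∀ (S : SerreFunctor k (Perf (PathAlgebra.WithRelations I)))
      (G : Perf (PathAlgebra.WithRelations I)), IsClassicalGenerator G →
        ((1 / ((l : ℝ) + 2) : ℝ) : EReal) ≤ LSdim S.functor G ∧ 0 < LSdim S.functor G) ∧
    Subsingleton (BimoduleTensorPower k (PathAlgebra.WithRelations I)
      (SerreBimodule k (PathAlgebra.WithRelations I)) (l + 2)) := by

  have he : IsDirectedFamily k (PathAlgebra.vertexIdem I) :=
    PathAlgebra.isDirectedFamily_vertexIdem hord
  have : FiniteDimensional k (PathAlgebra.WithRelations I) :=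
    PathAlgebra.finiteDimensional_withRelations hfin hord
  have : IsArtinianRing (PathAlgebra.WithRelations I)ᵐᵒᵖ := isArtinianRing_op k _
  have htensor : Subsingleton (BimoduleTensorPower k (PathAlgebra.WithRelations I)
      (SerreBimodule k (PathAlgebra.WithRelations I)) (l + 2)) :=
    PathAlgebra.subsingleton_bimoduleTensorPower_serreBimodule hord hconn hl hI
  refine ⟨nonempty_serreFunctor_perf.{u, max v w} he,
    ⟨_, isClassicalGenerator_regularPerf he⟩, fun S G _ => ?_, htensor⟩
  have h : ((1 / ((l : ℝ) + 2) : ℝ) : EReal) ≤ LSdim S.functor G := by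
    have := S.one_div_le_LSdim htensor (Nat.succ_pos _) G
    rwa [Nat.cast_add, Nat.cast_ofNat] at this
  refine ⟨h, lt_of_lt_of_le ?_ h⟩
  rw [EReal.coe_pos]
  positivity
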